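/- Let $X$ be a smooth projective (connected) curve over $\mathbb{C}$, let $E$ be a vector bundle on $X$, let $F\subset E$ be a subbundle with quotient bundle $G=E/F$, and assume $h^0(X,G\otimes E)=0$. Let $\mathrm{Sym}^2E\subset E\otimes E$ be the subbundle of symmetric tensors and let $\wedge^2G$ be the exterior square of $G$, the quotient of $G\otimes G$ by $\mathrm{Sym}^2 G$. The composite $\mathrm{Sym}^2E\to E\otimes E\to G\otimes E$ induces a short exact sequence $$0\to \frac{\mathrm{Sym}^2E}{\mathrm{Sym}^2F}\to G\otimes E\to \wedge^2G\to 0 ,$$ whose connecting homomorphism $$\partial\colon H^0(X,\wedge^2G)\to H^1\left(X,\frac{\mathrm{Sym}^2E}{\mathrm{Sym}^2F}\right)$$ is injective; regard $H^0(X,\wedge^2G)$ as a subspace of the target through $\partial$. The natural maps $H^1(X,\mathrm{Sym}^2F)\to H^1(X,\mathrm{Sym}^2E)\to H^1(X,E\otimes E)=H^1(X,\mathcal{H}om(E^*,E))$ are injective as well; regard them as inclusions. Let $b\colon H^1(X,\mathrm{Sym}^2E)\to H^1(X,\mathrm{Sym}^2E/\mathrm{Sym}^2F)$ be the map induced by the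 projection. Let $0\to E\to W\to E^*\to 0$ be a symplectic extension, that is, an extension whose class $\delta(W)\in H^1(X,\mathcal{H}om(E^*,E))$ (the image of $\mathrm{id}_{E^*}$ under the connecting homomorphism of $0\to\mathcal{H}om(E^*,E)\to\mathcal{H}om(E^*,W)\to\mathcal{H}om(E^*,E^*)\to0$) lies in $H^1(X,\mathrm{Sym}^2E)$. Then the inclusion $G^*\subset E^*$ lifts to a homomorphism $G^*\to W$ if and only if $b(\delta(W))\in H^0(X,\wedge^2G)$, i.e. $\delta(W)\in b^{-1}\left(H^0(X,\wedge^2G)\right)$. In particular, if $h^0(X,\wedge^2G)=0$, then $G^*$ lifts to $W$ if and only if $\delta(W)\in H^1(X,\mathrm{Sym}^2F)$. -/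

import Mathlib

open CategoryTheory AlgebraicGeometry Opposite TopologicalSpace

noncomputable section
namespace SymplecticLifting

variable {X : Scheme.{0}}

/-- Restriction of sections of an `𝒪_X`-module. -/
def res (M : X.Modules) {U V : X.Opens} (h : V ≤ U) : Γ(M, U) →+ Γ(M, V) :=
  (M.presheaf.map (homOfLE h).op).hom

lemma res_smul (M : X.Modules) {U V : X.Opens} (h : V ≤ U) (r : Γ(X, U)) (m : Γ(M, U)) :
    res M h (r • m) = X.presheaf.map (homOfLE h).op r • res M h m :=
  M.map_smul (homOfLE h) r m

lemma res_self (M : X.Modules) {U : X.Opens} (h : U ≤ U) (m : Γ(M, U)) : res M h m = m := by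
  simp [res]

lemma res_res (M : X.Modules) {U V W : X.Opens} (h : V ≤ U) (k : W ≤ V) (m : Γ(M, U)) :
    res M k (res M h m) = res M (k.trans h) m := by
  have : (homOfLE (k.trans h)).op = (homOfLE h).op ≫ (homOfLE k).op := rfl
  simp [res, this]

lemma app_res {M N : X.Modules} (f : M ⟶ N) {U V : X.Opens} (h : V ≤ U) (m : Γ(M, U)) :
    f.app V (res M h m) = res N h (f.app U m) :=
  ConcreteCategory.congr_hom (f.mapPresheaf.naturality (homOfLE h).op) m

/-- The structure sheaf as a module over itself. -/
def O (X : Scheme.{0}) : X.Modules := SheafOfModules.unit X.ringCatSheaf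

section AbelianSheaves

/-- The abelian sheaf underlying an `𝒪_X`-module. -/
def toAb (X : Scheme.{0}) :
    X.Modules ⥤ Sheaf (Opens.grothendieckTopology X) AddCommGrpCat.{0} :=
  SheafOfModules.toSheaf X.ringCatSheaf

/-- The sheaf cohomology group `Hⁿ(X, M)` of (the abelian sheaf underlying) an `𝒪_X`-module. -/
abbrev H (M : X.Modules) (n : ℕ) : Type := ((toAb X).obj M).H n

instance : (toAb X).Additive := inferInstanceAs (SheafOfModules.toSheaf X.ringCatSheaf).Additive
instance : Limits.PreservesFiniteLimits (toAb X) :=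
  inferInstanceAs <| Limits.PreservesFiniteLimits (SheafOfModules.toSheaf X.ringCatSheaf)

instance : Limits.PreservesFiniteColimits (toAb X) := by
  let L := PresheafOfModules.sheafification (𝟙 X.ringCatSheaf.obj)
  let T := SheafOfModules.toSheaf X.ringCatSheaf
  let adj := PresheafOfModules.sheafificationAdjunction (𝟙 X.ringCatSheaf.obj)
  change Limits.PreservesFiniteColimits T
  have hLT : Limits.PreservesFiniteColimits (L ⋙ T) := by
    have : Limits.PreservesFiniteColimits
      (PresheafOfModules.toPresheaf X.ringCatSheaf.obj ⋙ presheafToSheaf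
        (Opens.grothendieckTopology X) AddCommGrpCat.{0}) := inferInstance
    exact this
  have hL : Limits.PreservesFiniteColimits L := inferInstance
  refine ⟨fun K _ _ => ⟨fun {F} => ?_⟩⟩
  let G := F ⋙ SheafOfModules.forget X.ringCatSheaf ⋙
    PresheafOfModules.restrictScalars (𝟙 X.ringCatSheaf.obj)
  have h : Limits.PreservesColimit (G ⋙ L) T := by
    refine Limits.preservesColimit_of_preserves_colimit_cocone
      (Limits.isColimitOfPreserves L (Limits.colimit.isColimit G)) ?_
    exact Limits.isColimitOfPreserves (L ⋙ T) (Limits.colimit.isColimit G)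
  let e : G ⋙ L ≅ F := Functor.isoWhiskerLeft F (asIso adj.counit)
  exact Limits.preservesColimit_of_iso_diagram T e

end AbelianSheaves

section SheafHom

/-- The sections over `U` of the sheaf of homomorphisms from `M` to `N`: the `𝒪_U`-linear maps
from `M|_U` to `N|_U`, given as families of linear maps compatible with restriction. -/
@[ext]
structure HomSec (M N : X.Modules) (U : X.Opens) where
  app (V : X.Opens) (h : V ≤ U) : Γ(M, V) →ₗ[Γ(X, V)] Γ(N, V)
  compat {V W : X.Opens} (h : V ≤ U) (k : W ≤ V) (m : Γ(M, V)) :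
    app W (k.trans h) (res M k m) = res N k (app V h m)

namespace HomSec
variable {M N : X.Modules} {U V : X.Opens}

instance : Zero (HomSec M N U) := ⟨⟨fun _ _ => 0, by intros; simp⟩⟩
instance : Add (HomSec M N U) :=
  ⟨fun φ ψ => ⟨fun V h => φ.app V h + ψ.app V h, by
    intro V W h k m; simp [φ.compat h k m, ψ.compat h k m]⟩⟩
instance : Neg (HomSec M N U) :=
  ⟨fun φ => ⟨fun V h => - φ.app V h, by intro V W h k m; simp [φ.compat h k m]⟩⟩
instance : Sub (HomSec M N U) :=
  ⟨fun φ ψ => ⟨fun V h => φ.app V h - ψ.app V h, by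
    intro V W h k m; simp [φ.compat h k m, ψ.compat h k m]⟩⟩
instance : SMul ℕ (HomSec M N U) :=
  ⟨fun n φ => ⟨fun V h => n • φ.app V h, by intro V W h k m; simp [φ.compat h k m]⟩⟩
instance : SMul ℤ (HomSec M N U) :=
  ⟨fun n φ => ⟨fun V h => n • φ.app V h, by intro V W h k m; simp [φ.compat h k m]⟩⟩

/-- The underlying family of linear maps. -/
def toFamily (φ : HomSec M N U) (V : {V : X.Opens // V ≤ U}) :
    Γ(M, V.1) →ₗ[Γ(X, V.1)] Γ(N, V.1) := φ.app V.1 V.2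

lemma toFamily_injective : Function.Injective (toFamily (M := M) (N := N) (U := U)) := by
  intro φ ψ h
  refine HomSec.ext ?_
  funext V hV
  exact congrFun h ⟨V, hV⟩

instance : AddCommGroup (HomSec M N U) :=
  toFamily_injective.addCommGroup _ rfl (fun _ _ => rfl) (fun _ => rfl) (fun _ _ => rfl)
    (fun _ _ => rfl) (fun _ _ => rfl)

instance : Module Γ(X, U) (HomSec M N U) where
  smul r φ := ⟨fun V h => (X.presheaf.map (homOfLE h).op r) • φ.app V h, by
    intro V W h k m
    simp only [LinearMap.smul_apply, φ.compat h k m, res_smul]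
    congr 1
    exact ConcreteCategory.congr_hom (X.presheaf.map_comp (homOfLE h).op (homOfLE k).op) r⟩
  one_smul φ := by ext V h m; change X.presheaf.map (homOfLE h).op 1 • φ.app V h m = _; simp
  mul_smul r s φ := by
    ext V h m
    change X.presheaf.map (homOfLE h).op (r * s) • φ.app V h m = X.presheaf.map (homOfLE h).op r • X.presheaf.map (homOfLE h).op s • φ.app V h m
    simp [mul_smul]
  smul_zero r := by ext V h m; change X.presheaf.map (homOfLE h).op r • (0 : Γ(N, V)) = 0; simp
  smul_add r φ ψ := by
    ext V h m
    exact smul_add (X.presheaf.map (homOfLE h).op r) (φ.app V h m) (ψ.app V h m)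
  add_smul r s φ := by
    ext V h m
    change X.presheaf.map (homOfLE h).op (r + s) • φ.app V h m = X.presheaf.map (homOfLE h).op r • φ.app V h m + X.presheaf.map (homOfLE h).op s • φ.app V h m
    simp [add_smul]
  zero_smul φ := by ext V h m; change X.presheaf.map (homOfLE h).op 0 • φ.app V h m = 0; simp

@[simp] lemma add_app (φ ψ : HomSec M N U) (h : V ≤ U) (m : Γ(M, V)) :
    (φ + ψ).app V h m = φ.app V h m + ψ.app V h m := rfl
@[simp] lemma zero_app (h : V ≤ U) (m : Γ(M, V)) : (0 : HomSec M N U).app V h m = 0 := rfl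
@[simp] lemma smul_app (r : Γ(X, U)) (φ : HomSec M N U) (h : V ≤ U) (m : Γ(M, V)) :
    (r • φ).app V h m = X.presheaf.map (homOfLE h).op r • φ.app V h m := rfl

/-- Restriction of a homomorphism to a smaller open set. -/
def restr (h : V ≤ U) : HomSec M N U →+ HomSec M N V where
  toFun φ := ⟨fun W k => φ.app W (k.trans h), fun k l m => φ.compat (k.trans h) l m⟩
  map_zero' := rfl
  map_add' _ _ := rfl

@[simp] lemma restr_app (φ : HomSec M N U) (h : V ≤ U) {W : X.Opens} (k : W ≤ V) (m : Γ(M, W)) :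
   (restr h φ).app W k m = φ.app W (k.trans h) m := rfl

end HomSec

/-- The abelian presheaf `U ↦ Hom(M|_U, N|_U)`. -/
def homPresheaf (M N : X.Modules) : TopCat.Presheaf Ab X where
  obj U := AddCommGrpCat.of (HomSec M N U.unop)
  map i := AddCommGrpCat.ofHom (HomSec.restr (leOfHom i.unop))
  map_id _ := rfl
  map_comp _ _ := rfl

instance (M N : X.Modules) (U : (X.Opens)ᵒᵖ) :
    Module (X.ringCatSheaf.obj.obj U) ((homPresheaf M N).obj U) :=
  inferInstanceAs (Module Γ(X, U.unop) (HomSec M N U.unop))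

/-- The presheaf of modules `U ↦ Hom(M|_U, N|_U)`. -/
def homPresheafOfModules (M N : X.Modules) : X.PresheafOfModules :=
  PresheafOfModules.ofPresheaf (homPresheaf M N) (by
    intro U V i r φ
    refine HomSec.ext ?_
    funext W h
    ext m
    have hVU : V.unop ≤ U.unop := leOfHom i.unop
    change X.presheaf.map (homOfLE (h.trans hVU)).op r • φ.app W (h.trans hVU) m =
      X.presheaf.map (homOfLE h).op (X.presheaf.map i r) • φ.app W (h.trans hVU) m
    congr 1
    exact ConcreteCategory.congr_hom (X.presheaf.map_comp i (homOfLE h).op) r)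

lemma exists_glue (N : X.Modules) {ι : Type} (U : ι → X.Opens) (V : X.Opens)
    (hU : ∀ i, U i ≤ V) (hV : V ≤ iSup U)
    (s : ∀ i, Γ(N, U i))
    (hs : ∀ i j, res N (inf_le_left : U i ⊓ U j ≤ U i) (s i) = res N inf_le_right (s j)) :
    ∃! t : Γ(N, V), ∀ i, res N (hU i) t = s i :=
  TopCat.Sheaf.existsUnique_gluing' (C := AddCommGrpCat) ((toAb X).obj N) U V
    (fun i => homOfLE (hU i)) hV s hs

lemma homPresheaf_isSheaf (M N : X.Modules) : TopCat.Presheaf.IsSheaf (homPresheaf M N) := by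
  rw [TopCat.Presheaf.isSheaf_iff_isSheafUniqueGluing]
  intro ι U sf hsf
  let σ : ∀ i, HomSec M N (U i) := sf
  have hσ : ∀ i j (V : X.Opens) (hi : V ≤ U i) (hj : V ≤ U j) (m : Γ(M, V)),
      (σ i).app V hi m = (σ j).app V hj m := by
    intro i j V hi hj m
    have h : HomSec.restr (inf_le_left : U i ⊓ U j ≤ U i) (σ i) =
      HomSec.restr (inf_le_right : U i ⊓ U j ≤ U j) (σ j) := hsf i j
    exact congrArg (fun τ : HomSec M N (U i ⊓ U j) => τ.app V (le_inf hi hj) m) h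
  have hcov : ∀ V : X.Opens, V ≤ iSup U → V ≤ ⨆ i, V ⊓ U i := by
    intro V hV
    rw [← inf_iSup_eq]
    exact le_inf le_rfl hV
  have key : ∀ (V : X.Opens) (_ : V ≤ iSup U) (m : Γ(M, V)), ∃! t : Γ(N, V), ∀ i,
      res N (inf_le_left : V ⊓ U i ≤ V) t =
        (σ i).app (V ⊓ U i) inf_le_right (res M inf_le_left m) := by
    intro V hV m
    refine exists_glue N (fun i => V ⊓ U i) V (fun i => inf_le_left) (hcov V hV) _ ?_
    intro i j
    rw [← (σ i).compat, ← (σ j).compat, res_res, res_res]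
    exact hσ i j _ _ _ _
  choose F hF hF' using fun (V : X.Opens) (hV : V ≤ iSup U) (m : Γ(M, V)) => key V hV m
  dsimp only at hF hF'
  have hlin : ∀ (V : X.Opens) (hV : V ≤ iSup U), IsLinearMap Γ(X, V) (F V hV) := by
    intro V hV
    refine ⟨fun m m' => (hF' V hV _ _ fun i => ?_).symm, fun r m => (hF' V hV _ _ fun i => ?_).symm⟩
    · rw [map_add, hF V hV m i, hF V hV m' i, ← map_add, ← map_add]
    · rw [res_smul, hF V hV m i, ← map_smul, ← res_smul]
  have hFσ : ∀ (V : X.Opens) (hV : V ≤ iSup U) (i : ι) (hi : V ≤ U i) (m : Γ(M, V)),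
      F V hV m = (σ i).app V hi m := by
    intro V hV i hi m
    refine (hF' V hV _ _ fun j => ?_).symm
    rw [← (σ i).compat]
    exact hσ i j _ _ _ _
  let φ : HomSec M N (iSup U) :=
    { app := fun V hV => (hlin V hV).mk' _
      compat := by
        intro V W h k m
        change F W _ (res M k m) = res N k (F V h m)
        refine (hF' W _ _ _ fun i => ?_).symm
        rw [res_res, ← res_res N (inf_le_left : V ⊓ U i ≤ V) (inf_le_inf_right _ k), hF,
          ← (σ i).compat, res_res, res_res] }
  refine ⟨φ, fun i => ?_, fun ψ hψ => ?_⟩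
  · refine HomSec.ext ?_
    funext V hV
    ext m
    exact hFσ V _ i hV m
  · let ψ' : HomSec M N (iSup U) := ψ
    have hψ' : ∀ i, HomSec.restr (le_iSup U i) ψ' = σ i := hψ
    change ψ' = φ
    refine HomSec.ext ?_
    funext V hV
    ext m
    refine hF' V hV m _ fun i => ?_
    rw [← ψ'.compat, ← hψ' i]
    rfl

/-- The sheaf `ℋom(M, N)` of `𝒪_X`-linear homomorphisms. -/
def sheafHom (M N : X.Modules) : X.Modules :=
  { val := homPresheafOfModules M N
    isSheaf := homPresheaf_isSheaf M N }

/-- A morphism of `𝒪_X`-modules from compatible linear maps on sections. -/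
def mkHom {M N : X.Modules} (f : ∀ U : X.Opens, Γ(M, U) →ₗ[Γ(X, U)] Γ(N, U))
    (hf : ∀ {U V : X.Opens} (h : V ≤ U) (m : Γ(M, U)), f V (res M h m) = res N h (f U m)) :
    M ⟶ N :=
  ⟨PresheafOfModules.homMk
    { app U := AddCommGrpCat.ofHom (f U.unop).toAddMonoidHom
      naturality U V i := by
        ext m
        exact hf (leOfHom i.unop) m }
    (fun U r m => (f U.unop).map_smul r m)⟩

@[simp] lemma mkHom_app {M N : X.Modules} (f : ∀ U : X.Opens, Γ(M, U) →ₗ[Γ(X, U)] Γ(N, U))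
    (hf : ∀ {U V : X.Opens} (h : V ≤ U) (m : Γ(M, U)), f V (res M h m) = res N h (f U m))
    (U : X.Opens) (m : Γ(M, U)) : (mkHom f hf).app U m = f U m := rfl

/-- The linear map on sections induced by a morphism. -/
def appₗ {M N : X.Modules} (f : M ⟶ N) (U : X.Opens) : Γ(M, U) →ₗ[Γ(X, U)] Γ(N, U) where
  toFun := f.app U
  map_add' := map_add _
  map_smul' := f.app_smul

/-- Composition with `f : N ⟶ N'`, as a map from `ℋom(M, N)` to `ℋom(M, N')`. -/
def sheafHomMap (M : X.Modules) {N N' : X.Modules} (f : N ⟶ N') :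
    sheafHom M N ⟶ sheafHom M N' :=
  mkHom (fun U =>
    { toFun := fun φ : HomSec M N U => (⟨fun V h => appₗ f V ∘ₗ φ.app V h, by
        intro V W h k m
        change f.app W _ = res N' k (f.app V _)
        rw [φ.compat h k m, app_res]⟩ : HomSec M N' U)
      map_add' := by
        intro φ ψ
        refine HomSec.ext ?_
        funext V h
        exact LinearMap.comp_add _ _ _
      map_smul' := by
        intro r φ
        refine HomSec.ext ?_
        funext V h
        exact LinearMap.comp_smul _ _ _ })
    (fun _ _ => rfl)

/-- Composition with `f : M ⟶ M'`, as a map from `ℋom(M', N)` to `ℋom(M, N)`. -/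
def sheafHomPre {M M' : X.Modules} (f : M ⟶ M') (N : X.Modules) :
    sheafHom M' N ⟶ sheafHom M N :=
  mkHom (fun U =>
    { toFun := fun φ : HomSec M' N U => (⟨fun V h => φ.app V h ∘ₗ appₗ f V, by
        intro V W h k m
        change φ.app W _ (f.app W _) = res N k (φ.app V h (f.app V _))
        rw [app_res f k, φ.compat h k]⟩ : HomSec M N U)
      map_add' := by
        intro φ ψ
        rfl
      map_smul' := by
        intro r φ
        rfl })
    (fun _ _ => rfl)

/-- The dual `M^* = ℋom(M, 𝒪_X)`. -/
def dual (M : X.Modules) : X.Modules := sheafHom M (O X)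

/-- The transpose of a morphism. -/
def dualMap {M N : X.Modules} (f : M ⟶ N) : dual N ⟶ dual M := sheafHomPre f (O X)


end SheafHom

section Exactness

lemma mono_of_injective {M N : X.Modules} (f : M ⟶ N)
    (hf : ∀ U, Function.Injective (f.app U)) : Mono f where
  right_cancellation g h e := by
    refine Scheme.Modules.hom_ext _ _ fun U => ?_
    ext x
    exact hf U (ConcreteCategory.congr_hom (congrArg (fun k => k.app U) e) x)

lemma epi_of_locallySurjective {M N : X.Modules} (f : M ⟶ N)
    (hf : ∀ (U : X.Opens) (t : Γ(N, U)), ∀ x ∈ U, ∃ (V : X.Opens) (h : V ≤ U), x ∈ V ∧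
      ∃ s : Γ(M, V), f.app V s = res N h t) : Epi f := by
  have : Epi ((toAb X).map f) := by
    refine (TopCat.Sheaf.isLocallySurjective_iff_epi (C := AddCommGrpCat) _).1 ?_
    rw [TopCat.Presheaf.isLocallySurjective_iff]
    intro U t x hx
    obtain ⟨V, h, hxV, s, hs⟩ := hf U t x hx
    exact ⟨V, h, ⟨s, hs⟩, hxV⟩
  have : (toAb X).Faithful := inferInstanceAs (SheafOfModules.toSheaf X.ringCatSheaf).Faithful
  exact (toAb X).epi_of_epi_map inferInstance

lemma locallySurjective_of_epi {M N : X.Modules} (f : M ⟶ N) [Epi f] (U : X.Opens) (t : Γ(N, U))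
    (x : X) (hx : x ∈ U) : ∃ (V : X.Opens) (h : V ≤ U), x ∈ V ∧
      ∃ s : Γ(M, V), f.app V s = res N h t := by
  have hf : Epi ((toAb X).map f) := (toAb X).map_epi f
  have h := (TopCat.Sheaf.isLocallySurjective_iff_epi (C := AddCommGrpCat) ((toAb X).map f)).2 hf
  rw [TopCat.Presheaf.isLocallySurjective_iff] at h
  obtain ⟨V, h, ⟨s, hs⟩, hxV⟩ := h U t x hx
  exact ⟨V, h, hxV, s, hs⟩

lemma sections_exact {S : ShortComplex X.Modules} (hS : S.ShortExact) (U : X.Opens) :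
    Function.Injective (S.f.app U) ∧ ∀ n, S.g.app U n = 0 → ∃ m, S.f.app U m = n := by
  let E : X.Modules ⥤ ModuleCat (X.ringCatSheaf.obj.obj (op U)) :=
    SheafOfModules.evaluation X.ringCatSheaf (op U)
  have h1 : Limits.PreservesFiniteLimits E :=
    inferInstanceAs (Limits.PreservesFiniteLimits
      (SheafOfModules.evaluation X.ringCatSheaf (op U)))
  have h2 : E.Additive := Functor.additive_of_preserves_binary_products E
  have := hS.mono_f
  have h3 : (S.map E).Exact := hS.exact.map_of_mono_of_preservesKernel E inferInstance inferInstance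
  refine ⟨(ModuleCat.mono_iff_injective (E.map S.f)).1 inferInstance, ?_⟩
  rw [ShortComplex.moduleCat_exact_iff] at h3
  exact h3

lemma shortExact_of_sections {S : ShortComplex X.Modules}
    (h1 : ∀ U, Function.Injective (S.f.app U))
    (h2 : ∀ U n, S.g.app U n = 0 → ∃ m, S.f.app U m = n)
    (h3 : ∀ (U : X.Opens) (t : Γ(S.X₃, U)), ∀ x ∈ U, ∃ (V : X.Opens) (h : V ≤ U), x ∈ V ∧
      ∃ s : Γ(S.X₂, V), S.g.app V s = res S.X₃ h t) : S.ShortExact := by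
  have hf := mono_of_injective S.f h1
  have hg := epi_of_locallySurjective S.g h3
  refine ShortComplex.ShortExact.mk' ?_ hf hg
  refine S.exact_of_f_is_kernel ?_
  refine Limits.KernelFork.IsLimit.ofι' S.f S.zero fun {A} k hk => ?_
  have hk' : ∀ U a, ∃ m, S.f.app U m = k.app U a := fun U a => h2 U _
    (ConcreteCategory.congr_hom (congrArg (fun k => k.app U) hk) a)
  choose l hl using hk'
  refine ⟨mkHom (fun U =>
    { toFun := l U
      map_add' a b := h1 U (by rw [map_add]; simp only [hl, map_add])
      map_smul' r a := h1 U (by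
        rw [RingHom.id_apply, S.f.app_smul]; simp only [hl, k.app_smul]) }) ?_, ?_⟩
  · intro U V h m
    apply h1 V
    change S.f.app V (l V _) = S.f.app V (res _ _ (l U m))
    rw [app_res]; simp only [hl, app_res]
  · refine Scheme.Modules.hom_ext _ _ fun U => ?_
    ext a
    exact hl U a

end Exactness

section VectorBundle

/-- Sections `e₁, …, eₙ` of `M` over `U` form a frame if they induce an isomorphism from `𝒪_U^n`
to `M|_U`. -/
def IsFrame {M : X.Modules} {U : X.Opens} {n : ℕ} (e : Fin n → Γ(M, U)) : Prop :=
  ∀ (V : X.Opens) (h : V ≤ U),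
    Function.Bijective fun c : Fin n → Γ(X, V) => ∑ i, c i • res M h (e i)

/-- A vector bundle: an `𝒪_X`-module that is locally free of finite rank. -/
def IsVectorBundle (M : X.Modules) : Prop :=
  ∀ x : X, ∃ U : X.Opens, x ∈ U ∧ ∃ (n : ℕ) (e : Fin n → Γ(M, U)), IsFrame e

namespace IsFrame
variable {M : X.Modules} {U : X.Opens} {n : ℕ} {e : Fin n → Γ(M, U)}

lemma bijective (he : IsFrame e) {V : X.Opens} (h : V ≤ U) :
    Function.Bijective (Fintype.linearCombination Γ(X, V) fun i => res M h (e i)) := he V h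

/-- The basis of the module of sections over `V ≤ U` given by a frame over `U`. -/
def basis (he : IsFrame e) {V : X.Opens} (h : V ≤ U) : Module.Basis (Fin n) Γ(X, V) Γ(M, V) :=
  .ofEquivFun (LinearEquiv.ofBijective _ (he.bijective h)).symm

lemma basis_apply (he : IsFrame e) {V : X.Opens} (h : V ≤ U) (i : Fin n) :
    he.basis h i = res M h (e i) := by
  rw [basis, Module.Basis.coe_ofEquivFun, LinearEquiv.symm_symm]
  exact (Fintype.linearCombination_apply_single _ _ _ _).trans (one_smul _ _)

lemma res_basis (he : IsFrame e) {V W : X.Opens} (h : V ≤ U) (k : W ≤ V) (i : Fin n) :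
    res M k (he.basis h i) = he.basis (k.trans h) i := by
  rw [basis_apply, basis_apply, res_res]

lemma coord_basis (he : IsFrame e) {V : X.Opens} (h : V ≤ U) (i j : Fin n) :
    (he.basis h).coord i (he.basis h j) = if j = i then 1 else 0 := by
  rw [Module.Basis.coord_apply, Module.Basis.repr_self, Finsupp.single_apply]

lemma coord_res (he : IsFrame e) {V W : X.Opens} (h : V ≤ U) (k : W ≤ V) (m : Γ(M, V)) (i : Fin n) :
    (he.basis (k.trans h)).coord i (res M k m) =
      X.presheaf.map (homOfLE k).op ((he.basis h).coord i m) := by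
  have : res M k m = ∑ j, X.presheaf.map (homOfLE k).op ((he.basis h).coord j m) •
      he.basis (k.trans h) j := by
    calc res M k m = res M k (∑ j, (he.basis h).repr m j • he.basis h j) := by
          rw [Module.Basis.sum_repr]
      _ = _ := by
          rw [map_sum]
          refine Finset.sum_congr rfl fun j _ => ?_
          rw [res_smul, res_basis, Module.Basis.coord_apply]
  rw [this, map_sum, Finset.sum_eq_single i]
  · rw [map_smul, coord_basis, if_pos rfl, smul_eq_mul, mul_one]
  · intro j _ hj
    rw [map_smul, coord_basis, if_neg hj, smul_zero]
  · simp

/-- The frame of the dual formed by the coordinate functions of a frame. -/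
def dualFrame (he : IsFrame e) (i : Fin n) : Γ(dual M, U) :=
  (⟨fun _ h => (he.basis h).coord i, fun h k m => he.coord_res h k m i⟩ : HomSec M (O X) U)

lemma isFrame_dualFrame (he : IsFrame e) : IsFrame he.dualFrame := by
  intro V h
  have key : ∀ (c : Fin n → Γ(X, V)) (W : X.Opens) (k : W ≤ V) (m : Γ(M, W)),
      HomSec.app (M := M) (N := O X) (∑ i, c i • res (dual M) h (he.dualFrame i)) W k m =
        ∑ i, X.presheaf.map (homOfLE k).op (c i) * (he.basis (k.trans h)).coord i m := by
    intro c W k m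
    let ev : HomSec M (O X) V →+ Γ(X, W) :=
      { toFun := fun φ => φ.app W k m, map_zero' := rfl, map_add' := fun _ _ => rfl }
    exact map_sum ev (fun i => c i • (res (dual M) h (he.dualFrame i))) Finset.univ
  have key' : ∀ (c : Fin n → Γ(X, V)) (j : Fin n),
      HomSec.app (M := M) (N := O X) (∑ i, c i • res (dual M) h (he.dualFrame i)) V le_rfl
        (he.basis h j) = c j := by
    intro c j
    rw [key, Finset.sum_eq_single j]
    · rw [coord_basis, if_pos rfl, mul_one]
      exact ConcreteCategory.congr_hom (X.presheaf.map_id (op V)) (c j)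
    · intro i _ hi
      rw [coord_basis, if_neg hi.symm, mul_zero]
    · simp
  constructor
  · intro c d hcd
    funext j
    rw [← key' c j, ← key' d j]
    exact congrArg (fun φ : HomSec M (O X) V => φ.app V le_rfl (he.basis h j)) hcd
  · intro φ
    let φ' : HomSec M (O X) V := φ
    let c : Fin n → Γ(X, V) := fun i => φ'.app V le_rfl (he.basis h i)
    refine ⟨c, ?_⟩
    change (∑ i, c i • res (dual M) h (he.dualFrame i)) = _
    refine HomSec.ext (x := (_ : HomSec M (O X) V)) (y := φ') ?_
    funext W k
    refine (he.basis (k.trans h)).ext fun j => ?_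
    refine (key c W k _).trans ?_
    rw [Finset.sum_eq_single j]
    · rw [coord_basis, if_pos rfl, mul_one, ← he.res_basis h k, φ'.compat]
      rfl
    · intro i _ hi
      rw [coord_basis, if_neg hi.symm, mul_zero]
    · simp

end IsFrame


lemma IsVectorBundle.dual {M : X.Modules} (hM : IsVectorBundle M) : IsVectorBundle (dual M) := by
  intro x
  obtain ⟨U, hx, n, e, he⟩ := hM x
  exact ⟨U, hx, n, he.dualFrame, he.isFrame_dualFrame⟩

/-- The sequence `ℋom(M, S₁) ⟶ ℋom(M, S₂) ⟶ ℋom(M, S₃)`. -/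
def sheafHomSeq (M : X.Modules) (S : ShortComplex X.Modules) : ShortComplex X.Modules :=
  .mk (sheafHomMap M S.f) (sheafHomMap M S.g) (by
    refine Scheme.Modules.hom_ext _ _ fun U => ?_
    ext φ
    refine HomSec.ext (y := (0 : HomSec M S.X₃ U)) ?_
    funext V h
    ext m
    exact ConcreteCategory.congr_hom (congrArg (fun k => k.app V) S.zero)
      (HomSec.app (N := S.X₁) φ V h m))

lemma exists_common_nbhd {n : ℕ} {x : X} {U : X.Opens} (hx : x ∈ U)
    (P : Fin n → X.Opens → Prop) (hP : ∀ i V W, W ≤ V → P i V → P i W)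
    (h : ∀ i, ∃ V ≤ U, x ∈ V ∧ P i V) : ∃ V ≤ U, x ∈ V ∧ ∀ i, P i V := by
  choose V hVU hxV hPV using h
  refine ⟨U ⊓ Finset.univ.inf V, inf_le_left, ⟨hx, ?_⟩, fun i => hP i (V i) _
    (inf_le_right.trans (Finset.inf_le (Finset.mem_univ i))) (hPV i)⟩
  change x ∈ Finset.univ.inf V
  rw [← SetLike.mem_coe, Opens.coe_finset_inf]
  simpa [Finset.inf_eq_iInf] using hxV

lemma IsVectorBundle.sheafHomSeq_shortExact {M : X.Modules} (hM : IsVectorBundle M)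
    {S : ShortComplex X.Modules} (hS : S.ShortExact) : (sheafHomSeq M S).ShortExact := by
  refine shortExact_of_sections ?_ ?_ ?_
  · intro U φ ψ h
    refine HomSec.ext (x := (φ : HomSec M S.X₁ U)) (y := ψ) ?_
    funext V k
    ext m
    exact (sections_exact hS V).1 (congrArg (fun τ : HomSec M S.X₂ U => τ.app V k m) h)
  · intro U φ hφ
    let φ' : HomSec M S.X₂ U := φ
    have : ∀ (V : X.Opens) (k : V ≤ U) m, ∃ n, S.f.app V n = φ'.app V k m := fun V k m =>
      (sections_exact hS V).2 _ (congrArg (fun τ : HomSec M S.X₃ U => τ.app V k m) hφ)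
    choose l hl using this
    have inj := fun V => (sections_exact hS V).1
    let ψ : HomSec M S.X₁ U :=
      { app := fun V k =>
          { toFun := l V k
            map_add' a b := inj V (by rw [map_add]; simp only [hl, map_add])
            map_smul' r a := inj V (by
              rw [RingHom.id_apply, S.f.app_smul]; simp only [hl, map_smul]) }
        compat := by
          intro V W h k m
          apply inj W
          change S.f.app W (l W _ _) = S.f.app W (res _ _ (l V h m))
          rw [app_res, hl, hl, φ'.compat] }
    refine ⟨ψ, HomSec.ext (y := φ') ?_⟩
    funext V k
    ext m
    exact hl V k m
  · intro U t x hx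
    let τ : HomSec M S.X₃ U := t
    obtain ⟨U', hx', n, e, he⟩ := hM x
    have := hS.epi_g
    have hA : x ∈ U ⊓ U' := ⟨hx, hx'⟩
    have hAU : U ⊓ U' ≤ U := inf_le_left
    have hAU' : U ⊓ U' ≤ U' := inf_le_right
    obtain ⟨V, hV, hxV, hs⟩ := exists_common_nbhd hA
      (fun i V => ∃ (h : V ≤ U ⊓ U') (s : Γ(S.X₂, V)),
        S.g.app V s = res S.X₃ h (τ.app _ hAU (he.basis hAU' i)))
      (fun i V W hWV ⟨h, s, hs⟩ => ⟨hWV.trans h, res _ hWV s, by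
        rw [app_res, hs, res_res]⟩)
      (fun i => by
        obtain ⟨V, h, hxV, s, hs⟩ := locallySurjective_of_epi S.g (U ⊓ U')
          (τ.app _ hAU (he.basis hAU' i)) x hA
        exact ⟨V, h, hxV, h, s, hs⟩)
    choose hs0 s hs using hs
    let σ : HomSec M S.X₂ V :=
      { app := fun W k => (he.basis (k.trans (hV.trans hAU'))).constr Γ(X, W)
          fun i => res S.X₂ k (s i)
        compat := by
          intro W W' h k m
          rw [Module.Basis.constr_apply_fintype, Module.Basis.constr_apply_fintype, map_sum]
          refine Finset.sum_congr rfl fun i _ => ?_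
          rw [res_smul, res_res]
          congr 1
          exact he.coord_res _ k m i }
    refine ⟨V, hV.trans hAU, hxV, σ, ?_⟩
    refine HomSec.ext (x := (_ : HomSec M S.X₃ V)) (y := HomSec.restr (hV.trans hAU) τ) ?_
    funext W k
    refine (he.basis (k.trans (hV.trans hAU'))).ext fun j => ?_
    change S.g.app W ((he.basis _).constr Γ(X, W) (fun i => res S.X₂ k (s i)) (he.basis _ j)) =
      τ.app W _ (he.basis _ j)
    rw [Module.Basis.constr_basis, app_res, hs, ← τ.compat, ← τ.compat, he.res_basis, he.res_basis]


end VectorBundle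

section Tensor

/-- The presheaf `U ↦ Γ(M, U) ⊗ Γ(N, U)`. -/
def tensorPresheaf (M N : X.Modules) : X.PresheafOfModules :=
  PresheafOfModules.Monoidal.tensorObj (R := X.presheaf) M.val N.val

/-- The sheaf associated with a presheaf of `𝒪_X`-modules. -/
def sheafify (X : Scheme.{0}) : X.PresheafOfModules ⥤ X.Modules :=
  PresheafOfModules.sheafification (𝟙 X.ringCatSheaf.obj)

/-- The tensor product of `𝒪_X`-modules. -/
def tensor (M N : X.Modules) : X.Modules := (sheafify X).obj (tensorPresheaf M N)

/-- The tensor product of two morphisms. -/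
def tensorMap {M M' N N' : X.Modules} (f : M ⟶ M') (g : N ⟶ N') :
    tensor M N ⟶ tensor M' N' :=
  (sheafify X).map (PresheafOfModules.Monoidal.tensorHom (R := X.presheaf) f.val g.val)

/-- The map `m ⊗ n ↦ n ⊗ m`. -/
def swap (M : X.Modules) : tensor M M ⟶ tensor M M :=
  (sheafify X).map (BraidedCategory.braiding
    (C := _root_.PresheafOfModules (X.presheaf ⋙ forget₂ _ RingCat)) M.val M.val).hom

lemma tensorMap_swap {M N : X.Modules} (f : M ⟶ N) :
    tensorMap f f ≫ swap N = swap M ≫ tensorMap f f := by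
  refine ((sheafify X).map_comp _ _).symm.trans (Eq.trans ?_ ((sheafify X).map_comp _ _))
  congr 1
  exact BraidedCategory.braiding_naturality
    (C := _root_.PresheafOfModules (X.presheaf ⋙ forget₂ _ RingCat)) f.val f.val

/-- The map from the presheaf tensor product given by a bilinear map. -/
def tensorPresheafLift {M N K : X.Modules}
    (b : ∀ U : X.Opens, Γ(M, U) →ₗ[Γ(X, U)] Γ(N, U) →ₗ[Γ(X, U)] Γ(K, U))
    (hb : ∀ {U V : X.Opens} (h : V ≤ U) (m : Γ(M, U)) (n : Γ(N, U)),
      b V (res M h m) (res N h n) = res K h (b U m n)) : tensorPresheaf M N ⟶ K.val where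
  app U := ModuleCat.MonoidalCategory.tensorLift (R := X.presheaf.obj U)
    (M₁ := M.val.obj U) (M₂ := N.val.obj U) (M₃ := K.val.obj U) (fun m n => b U.unop m n)
    (fun m m' n => LinearMap.map_add₂ (b U.unop) m m' n)
    (fun r m n => LinearMap.map_smul₂ (b U.unop) r m n)
    (fun m n n' => (b U.unop m).map_add n n')
    (fun r m n => (b U.unop m).map_smul r n)
  naturality {U V} i := ModuleCat.MonoidalCategory.tensor_ext (by
    intro m n
    exact hb (leOfHom i.unop) m n)

/-- The map from the tensor product given by a bilinear map. -/
def tensorLift {M N K : X.Modules}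
    (b : ∀ U : X.Opens, Γ(M, U) →ₗ[Γ(X, U)] Γ(N, U) →ₗ[Γ(X, U)] Γ(K, U))
    (hb : ∀ {U V : X.Opens} (h : V ≤ U) (m : Γ(M, U)) (n : Γ(N, U)),
      b V (res M h m) (res N h n) = res K h (b U m n)) : tensor M N ⟶ K :=
  (PresheafOfModules.sheafificationHomEquiv (𝟙 X.ringCatSheaf.obj)).symm
    (tensorPresheafLift b hb)

lemma congr_presheafHom {P Q : X.PresheafOfModules} {f g : P ⟶ Q} (h : f = g) (U : X.Opens)
    (x : P.obj (op U)) : f.app (op U) x = g.app (op U) x := by rw [h]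

/-- The map from a presheaf of modules to the associated sheaf. -/
def toSheafify (P : X.PresheafOfModules) : P ⟶ ((sheafify X).obj P).val :=
  (PresheafOfModules.sheafificationAdjunction (𝟙 X.ringCatSheaf.obj)).unit.app P

lemma toSheafify_naturality {P Q : X.PresheafOfModules} (f : P ⟶ Q) :
    f ≫ toSheafify Q = toSheafify P ≫ ((sheafify X).map f).val :=
  (PresheafOfModules.sheafificationAdjunction (𝟙 X.ringCatSheaf.obj)).unit.naturality f

/-- The section `m ⊗ n`. -/
def tmul {M N : X.Modules} {U : X.Opens} (m : Γ(M, U)) (n : Γ(N, U)) : Γ(tensor M N, U) :=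
  (toSheafify (tensorPresheaf M N)).app (op U) (m ⊗ₜ[Γ(X, U)] n)

lemma tensorLift_tmul {M N K : X.Modules}
    (b : ∀ U : X.Opens, Γ(M, U) →ₗ[Γ(X, U)] Γ(N, U) →ₗ[Γ(X, U)] Γ(K, U))
    (hb : ∀ {U V : X.Opens} (h : V ≤ U) (m : Γ(M, U)) (n : Γ(N, U)),
      b V (res M h m) (res N h n) = res K h (b U m n)) {U : X.Opens} (m : Γ(M, U)) (n : Γ(N, U)) :
    (tensorLift b hb).app U (tmul m n) = b U m n := by
  have h : toSheafify (tensorPresheaf M N) ≫ (tensorLift b hb).val = tensorPresheafLift b hb :=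
    (PresheafOfModules.sheafificationHomEquiv (𝟙 X.ringCatSheaf.obj)).apply_symm_apply
      (tensorPresheafLift b hb)
  exact congr_presheafHom h U (m ⊗ₜ[Γ(X, U)] n)

lemma tensorMap_tmul {M M' N N' : X.Modules} (f : M ⟶ M') (g : N ⟶ N') {U : X.Opens}
    (m : Γ(M, U)) (n : Γ(N, U)) :
    (tensorMap f g).app U (tmul m n) = tmul (f.app U m) (g.app U n) :=
  (congr_presheafHom (toSheafify_naturality
    (PresheafOfModules.Monoidal.tensorHom (R := X.presheaf) f.val g.val)) U
    (m ⊗ₜ[Γ(X, U)] n)).symm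

lemma swap_tmul {M : X.Modules} {U : X.Opens} (m : Γ(M, U)) (n : Γ(M, U)) :
    (swap M).app U (tmul m n) = tmul n m :=
  (congr_presheafHom (toSheafify_naturality
    (BraidedCategory.braiding (C := _root_.PresheafOfModules (X.presheaf ⋙ forget₂ _ RingCat))
      M.val M.val).hom) U (m ⊗ₜ[Γ(X, U)] n)).symm

/-- The value `φ(y)` of a section of the dual on a section. -/
def pairing {E : X.Modules} {U : X.Opens} (φ : Γ(dual E, U)) (y : Γ(E, U)) : Γ(X, U) :=
  HomSec.app (M := E) (N := O X) φ U le_rfl y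

section pairing
variable {E : X.Modules} {U : X.Opens} (φ ψ : Γ(dual E, U)) (x y : Γ(E, U)) (r : Γ(X, U))

lemma pairing_add : pairing φ (x + y) = pairing φ x + pairing φ y :=
  (HomSec.app (M := E) (N := O X) φ U le_rfl).map_add x y

lemma pairing_smul : pairing φ (r • x) = r * pairing φ x :=
  (HomSec.app (M := E) (N := O X) φ U le_rfl).map_smul r x

lemma add_pairing : pairing (φ + ψ) x = pairing φ x + pairing ψ x := rfl

lemma smul_pairing : pairing (r • φ) x = r * pairing φ x := by
  have h : X.presheaf.map (homOfLE (le_refl U)).op r = r :=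
    ConcreteCategory.congr_hom (X.presheaf.map_id (op U)) r
  change X.presheaf.map (homOfLE (le_refl U)).op r * pairing φ x = _
  rw [h]

lemma pairing_res {V : X.Opens} (h : V ≤ U) :
    pairing (res (dual E) h φ) (res E h x) = X.presheaf.map (homOfLE h).op (pairing φ x) :=
  HomSec.compat (M := E) (N := O X) φ le_rfl h x

end pairing

/-- The homomorphism `φ ↦ φ(y) x` from `N^*` to `M`. -/
def rankOne {M N : X.Modules} {U : X.Opens} (x : Γ(M, U)) (y : Γ(N, U)) :
    HomSec (dual N) M U where
  app V h :=
    { toFun := fun φ => pairing φ (res N h y) • res M h x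
      map_add' := fun φ ψ => by rw [add_pairing, add_smul]
      map_smul' := fun r φ => by rw [smul_pairing, mul_smul, RingHom.id_apply] }
  compat {V W} h k φ := by
    change pairing (res _ k φ) (res N _ y) • res M _ x =
      res M k (pairing φ (res N h y) • res M h x)
    rw [res_smul, ← pairing_res, res_res, res_res]

lemma rankOne_app {M N : X.Modules} {U V : X.Opens} (x : Γ(M, U)) (y : Γ(N, U)) (h : V ≤ U)
    (φ : Γ(dual N, V)) : (rankOne x y).app V h φ = pairing φ (res N h y) • res M h x := rfl

lemma homSec_ext {M N : X.Modules} {U : X.Opens} {φ ψ : HomSec M N U}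
    (h : ∀ (V : X.Opens) (k : V ≤ U) (m : Γ(M, V)), φ.app V k m = ψ.app V k m) : φ = ψ :=
  HomSec.ext (by funext V k; exact LinearMap.ext (h V k))

/-- The bilinear map `(x, y) ↦ (φ ↦ φ(y) x)`. -/
def rankOneBilin (M N : X.Modules) (U : X.Opens) :
    Γ(M, U) →ₗ[Γ(X, U)] Γ(N, U) →ₗ[Γ(X, U)] Γ(sheafHom (dual N) M, U) :=
  LinearMap.mk₂ Γ(X, U)
    (fun x y => (rankOne x y : HomSec (dual N) M U))
    (fun x z y => homSec_ext (φ := rankOne (x + z) y) (ψ := rankOne x y + rankOne z y)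
      fun V h φ => by
        rw [HomSec.add_app, rankOne_app, rankOne_app, rankOne_app, map_add, smul_add])
    (fun r x y => homSec_ext (φ := rankOne (r • x) y) (ψ := r • rankOne x y)
      fun V h φ => by
        rw [HomSec.smul_app, rankOne_app, rankOne_app, res_smul, smul_comm])
    (fun x y z => homSec_ext (φ := rankOne x (y + z)) (ψ := rankOne x y + rankOne x z)
      fun V h φ => by
        rw [HomSec.add_app, rankOne_app, rankOne_app, rankOne_app, map_add, pairing_add,
          add_smul])
    (fun r x y => homSec_ext (φ := rankOne x (r • y)) (ψ := r • rankOne x y)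
      fun V h φ => by
        rw [HomSec.smul_app, rankOne_app, rankOne_app, res_smul, pairing_smul, mul_smul])

lemma rankOneBilin_res {M N : X.Modules} {U V : X.Opens} (h : V ≤ U) (x : Γ(M, U))
    (y : Γ(N, U)) : rankOneBilin M N V (res M h x) (res N h y) =
      res (sheafHom (dual N) M) h (rankOneBilin M N U x y) :=
  homSec_ext (φ := rankOne (res M h x) (res N h y)) (ψ := HomSec.restr h (rankOne x y))
    fun W k φ => by
      rw [HomSec.restr_app, rankOne_app, rankOne_app, res_res, res_res]

/-- The canonical map `M ⊗ N ⟶ ℋom(N^*, M)`, `x ⊗ y ↦ (φ ↦ φ(y) x)`; it is an isomorphism if `M`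
and `N` are vector bundles. -/
def tensorToHom (M N : X.Modules) : tensor M N ⟶ sheafHom (dual N) M :=
  tensorLift (rankOneBilin M N) rankOneBilin_res

lemma tensorToHom_tmul {M N : X.Modules} {U : X.Opens} (x : Γ(M, U)) (y : Γ(N, U)) :
    (tensorToHom M N).app U (tmul x y) = (rankOne x y : HomSec (dual N) M U) :=
  tensorLift_tmul (rankOneBilin M N) rankOneBilin_res x y

lemma tensorMap_comp {L M N L' M' N' : X.Modules} (f : L ⟶ M) (g : M ⟶ N)
    (f' : L' ⟶ M') (g' : M' ⟶ N') :
    tensorMap f f' ≫ tensorMap g g' = tensorMap (f ≫ g) (f' ≫ g') := by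
  refine ((sheafify X).map_comp _ _).symm.trans ?_
  congr 1
  exact MonoidalCategory.tensorHom_comp_tensorHom
    (C := _root_.PresheafOfModules (X.presheaf ⋙ forget₂ _ RingCat)) f.val f'.val g.val g'.val

lemma zero_tensorMap {M N M' N' : X.Modules} (g : M' ⟶ N') :
    tensorMap (0 : M ⟶ N) g = 0 := by
  have h : PresheafOfModules.Monoidal.tensorHom (R := X.presheaf) (0 : M ⟶ N).val g.val = 0 := by
    ext U : 1
    exact ModuleCat.MonoidalCategory.tensor_ext (fun m n => TensorProduct.zero_tmul _ _)
  unfold tensorMap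
  rw [h]
  have : (sheafify X).PreservesZeroMorphisms := by
    have : (sheafify X).IsLeftAdjoint :=
      (PresheafOfModules.sheafificationAdjunction (𝟙 X.ringCatSheaf.obj)).isLeftAdjoint
    infer_instance
  exact (sheafify X).map_zero _ _

end Tensor

section SymmetricSquare

/-- The symmetric square, as the subsheaf of symmetric tensors in `E ⊗ E`. -/
def sym2 (E : X.Modules) : X.Modules := Limits.kernel (𝟙 (tensor E E) - swap E)

/-- The inclusion of the symmetric square into `E ⊗ E`. -/
def sym2ι (E : X.Modules) : sym2 E ⟶ tensor E E := Limits.kernel.ι (𝟙 (tensor E E) - swap E)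

/-- The map between symmetric squares induced by a morphism. -/
def sym2Map {F E : X.Modules} (i : F ⟶ E) : sym2 F ⟶ sym2 E :=
  Limits.kernel.map _ _ (tensorMap i i) (tensorMap i i) (by
    rw [Preadditive.comp_sub, Preadditive.sub_comp, tensorMap_swap, Category.comp_id,
      Category.id_comp])

lemma sym2Map_ι {F E : X.Modules} (i : F ⟶ E) :
    sym2Map i ≫ sym2ι E = sym2ι F ≫ tensorMap i i :=
  Limits.kernel.lift_ι _ _ _

/-- The exterior square, as the subsheaf of `G ⊗ G` generated by the tensors `x ⊗ y - y ⊗ x`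
(the image of the antisymmetrization `G ⊗ G ⟶ G ⊗ G`, with kernel the symmetric square). -/
def alt2 (G : X.Modules) : X.Modules := Limits.image (𝟙 (tensor G G) - swap G)

/-- The inclusion of the exterior square into `G ⊗ G`. -/
def alt2ι (G : X.Modules) : alt2 G ⟶ tensor G G := Limits.image.ι (𝟙 (tensor G G) - swap G)

instance (G : X.Modules) : Mono (alt2ι G) :=
  inferInstanceAs (Mono (Limits.image.ι (𝟙 (tensor G G) - swap G)))

/-- The projection `x ⊗ y ↦ x ∧ y` from `G ⊗ G` to the exterior square. -/
def toAlt2 (G : X.Modules) : tensor G G ⟶ alt2 G :=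
  Limits.factorThruImage (𝟙 (tensor G G) - swap G)

lemma toAlt2_ι (G : X.Modules) :
    toAlt2 G ≫ alt2ι G = 𝟙 (tensor G G) - swap G :=
  Limits.image.fac _

/-- The quotient `Sym² E / Sym² F`. -/
def symQuot {F E : X.Modules} (i : F ⟶ E) : X.Modules := Limits.cokernel (sym2Map i)

/-- The projection from `Sym² E` to `Sym² E / Sym² F`. -/
def toSymQuot {F E : X.Modules} (i : F ⟶ E) : sym2 E ⟶ symQuot i :=
  Limits.cokernel.π (sym2Map i)

variable {F E G : X.Modules}

/-- For `i : F ⟶ E` and `q : E ⟶ G` with `q ∘ i = 0`, the map `Sym² E / Sym² F ⟶ G ⊗ E` induced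
by `Sym² E ⟶ E ⊗ E ⟶ G ⊗ E`. -/
def symQuotι (i : F ⟶ E) (q : E ⟶ G) (w : i ≫ q = 0) : symQuot i ⟶ tensor G E :=
  Limits.cokernel.desc (sym2Map i) (sym2ι E ≫ tensorMap q (𝟙 E)) (by
    rw [← Category.assoc, sym2Map_ι, Category.assoc, tensorMap_comp, w, zero_tensorMap,
      Limits.comp_zero])

lemma toSymQuot_ι (i : F ⟶ E) (q : E ⟶ G) (w : i ≫ q = 0) :
    toSymQuot i ≫ symQuotι i q w = sym2ι E ≫ tensorMap q (𝟙 E) :=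
  Limits.cokernel.π_desc _ _ _

/-- The sequence `Sym² E / Sym² F ⟶ G ⊗ E ⟶ ∧² G`. -/
def symQuotSeq (i : F ⟶ E) (q : E ⟶ G) (w : i ≫ q = 0) : ShortComplex X.Modules :=
  .mk (symQuotι i q w) (tensorMap (𝟙 G) q ≫ toAlt2 G) (by
    have h : Epi (toSymQuot i) := inferInstanceAs (Epi (Limits.cokernel.π (sym2Map i)))
    rw [← cancel_epi (toSymQuot i), ← Category.assoc, toSymQuot_ι, Limits.comp_zero,
      ← cancel_mono (alt2ι G), Limits.zero_comp]
    simp only [Category.assoc, toAlt2_ι]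
    rw [← Category.assoc (tensorMap q (𝟙 E)), tensorMap_comp, Category.comp_id,
      Category.id_comp, Preadditive.comp_sub, tensorMap_swap, Category.comp_id]
    have h' : sym2ι E ≫ (𝟙 (tensor E E) - swap E) = 0 := Limits.kernel.condition _
    have h'' : tensorMap q q - swap E ≫ tensorMap q q =
        (𝟙 (tensor E E) - swap E) ≫ tensorMap q q := by
      rw [Preadditive.sub_comp, Category.id_comp]
    rw [h'', ← Category.assoc, h', Limits.zero_comp])

end SymmetricSquare

section Cohomology

/-- The map in cohomology induced by a morphism. -/
def H.map {M N : X.Modules} (f : M ⟶ N) (n : ℕ) : H M n →+ H N n :=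
  Sheaf.H.map ((toAb X).map f) n

/-- The class in `H⁰(X, M)` of a global section. -/
def H.ofSection {M : X.Modules} (s : Γ(M, ⊤)) : H M 0 :=
  (Sheaf.H.equiv₀ ((toAb X).obj M) Limits.isTerminalTop).symm s

/-- The connecting homomorphism `H⁰(X, S₃) ⟶ H¹(X, S₁)` of a short exact sequence. -/
def connecting {S : ShortComplex X.Modules} (hS : S.ShortExact) : H S.X₃ 0 →+ H S.X₁ 1 :=
  (hS.map_of_exact (toAb X)).extClass.postcomp _ (zero_add 1)

/-- The identity of `M`, as a global section of `ℋom(M, M)`. -/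
def idSection (M : X.Modules) : Γ(sheafHom M M, ⊤) :=
  ({ app := fun _ _ => LinearMap.id, compat := fun _ _ _ => rfl } : HomSec M M ⊤)

/-- The class `δ(W)` in `H¹(X, ℋom(E^*, E))` of an extension `0 ⟶ E ⟶ W ⟶ E^* ⟶ 0`: the image of
the identity of `E^*` under the connecting homomorphism of
`0 ⟶ ℋom(E^*, E) ⟶ ℋom(E^*, W) ⟶ ℋom(E^*, E^*) ⟶ 0`. -/
def extensionClass {E W : X.Modules} (hE : IsVectorBundle E) {j : E ⟶ W} {p : W ⟶ dual E}
    {w : j ≫ p = 0} (h : (ShortComplex.mk j p w).ShortExact) : H (sheafHom (dual E) E) 1 :=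
  connecting (hE.dual.sheafHomSeq_shortExact h) (H.ofSection (idSection (dual E)))

/-- The map `H¹(X, Sym² E) ⟶ H¹(X, E ⊗ E) ⟶ H¹(X, ℋom(E^*, E))` by which symmetric classes are
regarded as classes of extensions of `E^*` by `E`. -/
def symClassMap (E : X.Modules) : H (sym2 E) 1 →+ H (sheafHom (dual E) E) 1 :=
  (H.map (tensorToHom E E) 1).comp (H.map (sym2ι E) 1)

/-- The subsheaf `G^*` of `E^*`, embedded by the transpose of `q : E ⟶ G`, lifts to `W`. -/
def Lifts {E G W : X.Modules} (q : E ⟶ G) (p : W ⟶ dual E) : Prop :=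
  ∃ l : dual G ⟶ W, l ≫ p = dualMap q

end Cohomology

end SymplecticLifting
end

open SymplecticLifting

/-! By naturality of connecting homomorphisms, the obstruction to lifting `G^* ⊂ E^*` to `W` is the
restriction of `δ(W)` to `H¹(ℋom(G^*, E))` (`lifts_iff`). The isomorphisms `ℋom(G^*, E) ≅ E ⊗ G ≅ G
⊗ E` turn restriction along `G^* ⊂ E^*` into the map `1 ⊗ q` followed by the flip. On symmetric
tensors this agrees with `q ⊗ 1`, which factors through `Sym² E / Sym² F`. So for a symmetric class
`δ` the obstruction is the image of `b(δ)` in `H¹(G ⊗ E)` (`map_symClassMap_eq_zero_iff`). By the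
long exact sequence of `symQuotSeq`, it vanishes exactly when `b(δ)` is in the image of `∂`.

The assumption `h⁰(G ⊗ E) = 0` makes `∂` injective. It also kills `H⁰(Sym² E / Sym² F)`, a subgroup
of `H⁰(G ⊗ E)`, whence `H¹(Sym² F)` injects into `H¹(Sym² E)`. Symmetrization, divided by 2, splits
`Sym² E` off `E ⊗ E`, so `symClassMap` is injective.

Most of the work is the exactness of `symQuotSeq` (`mono_symQuotι`, `symQuotSeq_exact`). It rests on
the exactness of tensoring with a vector bundle, deduced from `tensorToHom` being an isomorphism. -/

noncomputable section
namespace SymplecticLifting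

variable {X : Scheme.{0}}

/-! ### Morphisms out of tensor products, and the flip -/

section TensorExtensionality

/-- A map from a sheafification to a sheaf is determined on the presheaf, where pure tensors
generate. Identities between maps of tensor sheaves thus become computations with `tmul`. -/
lemma tensor_hom_ext {M N K : X.Modules} {f g : tensor M N ⟶ K}
    (h : ∀ (U : X.Opens) (m : Γ(M, U)) (n : Γ(N, U)),
      f.app U (tmul m n) = g.app U (tmul m n)) : f = g := by
  apply (PresheafOfModules.sheafificationHomEquiv (𝟙 X.ringCatSheaf.obj)).injective
  ext U : 1
  exact ModuleCat.MonoidalCategory.tensor_ext fun m n => h U.unop m n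

lemma comp_app_apply {M N K : X.Modules} (f : M ⟶ N) (g : N ⟶ K) {U : X.Opens} (m : Γ(M, U)) :
    (f ≫ g).app U m = g.app U (f.app U m) := rfl

lemma id_app_apply (M : X.Modules) {U : X.Opens} (m : Γ(M, U)) : (𝟙 M : M ⟶ M).app U m = m := rfl

/-- The map `m ⊗ n ↦ n ⊗ m` from `M ⊗ N` to `N ⊗ M`. -/
def braid (M N : X.Modules) : tensor M N ⟶ tensor N M :=
  (sheafify X).map (BraidedCategory.braiding
    (C := _root_.PresheafOfModules (X.presheaf ⋙ forget₂ _ RingCat)) M.val N.val).hom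

lemma braid_self (M : X.Modules) : braid M M = swap M := rfl

lemma braid_tmul {M N : X.Modules} {U : X.Opens} (m : Γ(M, U)) (n : Γ(N, U)) :
    (braid M N).app U (tmul m n) = tmul n m :=
  (congr_presheafHom (toSheafify_naturality
    (BraidedCategory.braiding (C := _root_.PresheafOfModules (X.presheaf ⋙ forget₂ _ RingCat))
      M.val N.val).hom) U (m ⊗ₜ[Γ(X, U)] n)).symm

lemma braid_braid (M N : X.Modules) : braid M N ≫ braid N M = 𝟙 _ :=
  tensor_hom_ext fun U m n => by
    rw [comp_app_apply, braid_tmul, braid_tmul, id_app_apply]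

lemma tensorMap_braid {M N M' N' : X.Modules} (f : M ⟶ M') (g : N ⟶ N') :
    tensorMap f g ≫ braid M' N' = braid M N ≫ tensorMap g f :=
  tensor_hom_ext fun U m n => by
    rw [comp_app_apply, comp_app_apply, tensorMap_tmul, braid_tmul, braid_tmul, tensorMap_tmul]

/-- The isomorphism `M ⊗ N ≅ N ⊗ M`. -/
def braidIso (M N : X.Modules) : tensor M N ≅ tensor N M where
  hom := braid M N
  inv := braid N M
  hom_inv_id := braid_braid M N
  inv_hom_id := braid_braid N M

end TensorExtensionality

/-! ### The isomorphism between `M ⊗ N` and `ℋom(N^*, M)` -/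

section TensorToHom

lemma tensorToHom_naturality {M N M' N' : X.Modules} (f : M ⟶ M') (g : N ⟶ N') :
    tensorMap f g ≫ tensorToHom M' N' =
      tensorToHom M N ≫ sheafHomMap (dual N) f ≫ sheafHomPre (dualMap g) M' := by
  refine tensor_hom_ext fun U m n => ?_
  rw [comp_app_apply, tensorMap_tmul, tensorToHom_tmul, comp_app_apply, tensorToHom_tmul]
  refine homSec_ext (ψ := (_ : HomSec (dual N') M' U)) fun V h φ => ?_
  change pairing φ (res N' h (g.app U n)) • res M' h (f.app U m) =
    f.app V (pairing ((dualMap g).app V φ) (res N h n) • res M h m)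
  rw [f.app_smul, app_res, ← app_res]
  rfl

/-- Both sections glue the same local data, and gluing is unique. -/
lemma eq_of_locally_eq (M : X.Modules) {U : X.Opens} (s t : Γ(M, U))
    (h : ∀ x ∈ U, ∃ (V : X.Opens) (k : V ≤ U), x ∈ V ∧ res M k s = res M k t) : s = t := by
  choose V k hx hV using fun x : U => h x.1 x.2
  have hU : U ≤ iSup V := fun x hxU => Opens.mem_iSup.2 ⟨⟨x, hxU⟩, hx _⟩
  obtain ⟨r, -, hr⟩ := exists_glue M V U k hU (fun x => res M (k x) s)
    (fun x y => by rw [res_res, res_res])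
  exact (hr s fun x => rfl).trans (hr t fun x => (hV x).symm).symm

lemma toSheafify_locallySurjective (P : X.PresheafOfModules) {U : X.Opens}
    (t : Γ((sheafify X).obj P, U)) (x : X) (hx : x ∈ U) :
    ∃ (V : X.Opens) (h : V ≤ U), x ∈ V ∧ ∃ s : P.obj (op V),
      (toSheafify P).app (op V) s = res ((sheafify X).obj P) h t := by
  have h : Presheaf.IsLocallySurjective (Opens.grothendieckTopology X)
      (CategoryTheory.toSheafify (Opens.grothendieckTopology X) P.presheaf) := inferInstance
  obtain ⟨V, i, ⟨s, hs⟩, hxV⟩ := h.imageSieve_mem t x hx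
  exact ⟨V, leOfHom i, hxV, s, hs⟩

/-- A tensor over an open set with a frame of the second factor is a sum of pure tensors with the
members of the frame. -/
lemma IsFrame.exists_tensor_eq_sum {M N : X.Modules} {U : X.Opens} {n : ℕ} {e : Fin n → Γ(N, U)}
    (he : IsFrame e) {V : X.Opens} (h : V ≤ U) (u : TensorProduct Γ(X, V) Γ(M, V) Γ(N, V)) :
    ∃ m : Fin n → Γ(M, V), u = ∑ i, m i ⊗ₜ[Γ(X, V)] res N h (e i) := by
  induction u using TensorProduct.induction_on with
  | zero => exact ⟨0, by simp⟩
  | add u v hu hv =>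
    obtain ⟨m, rfl⟩ := hu
    obtain ⟨m', rfl⟩ := hv
    exact ⟨m + m', by simp [TensorProduct.add_tmul, Finset.sum_add_distrib]⟩
  | tmul a b =>
    refine ⟨fun i => (he.basis h).coord i b • a, ?_⟩
    conv_lhs => rw [← (he.basis h).sum_repr b, TensorProduct.tmul_sum]
    refine Finset.sum_congr rfl fun i _ => ?_
    rw [TensorProduct.smul_tmul, he.basis_apply, Module.Basis.coord_apply]

/-- This local normal form has coefficients `m i` that can be read off by evaluating against the
dual frame, which is how injectivity of `tensorToHom` is tested. -/
lemma exists_local_eq_sum_tmul {M N : X.Modules} (hN : IsVectorBundle N) {U : X.Opens}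
    (t : Γ(tensor M N, U)) (x : X) (hx : x ∈ U) :
    ∃ (V : X.Opens) (h : V ≤ U), x ∈ V ∧ ∃ (n : ℕ) (e : Fin n → Γ(N, V)) (m : Fin n → Γ(M, V)),
      IsFrame e ∧ res (tensor M N) h t = ∑ i, tmul (m i) (e i) := by
  obtain ⟨U', hx', n, e, he⟩ := hN x
  obtain ⟨V, h, hxV, u, hu⟩ := toSheafify_locallySurjective (tensorPresheaf M N)
    (res (tensor M N) (inf_le_left : U ⊓ U' ≤ U) t) x ⟨hx, hx'⟩
  have hVU' : V ≤ U' := h.trans inf_le_right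
  obtain ⟨m, rfl⟩ := he.exists_tensor_eq_sum hVU' u
  refine ⟨V, h.trans inf_le_left, hxV, n, fun i => res N hVU' (e i), m, fun W k => ?_, ?_⟩
  · simp only [res_res]
    exact he W (k.trans hVU')
  · exact ((res_res (tensor M N) _ h t).symm.trans hu.symm).trans (map_sum
      ((toSheafify (tensorPresheaf M N)).app (op V)).hom _ _)

lemma IsFrame.pairing_dualFrame {N : X.Modules} {U : X.Opens} {n : ℕ} {e : Fin n → Γ(N, U)}
    (he : IsFrame e) (i j : Fin n) : pairing (he.dualFrame i) (e j) = if j = i then 1 else 0 := by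
  have h := he.coord_basis le_rfl i j
  rwa [he.basis_apply, res_self] at h

lemma tensorToHom_app_sum_tmul {M N : X.Modules} {U : X.Opens} {n : ℕ} {e : Fin n → Γ(N, U)}
    (m : Fin n → Γ(M, U)) {V : X.Opens} (h : V ≤ U) (φ : Γ(dual N, V)) :
    HomSec.app (M := dual N) (N := M) ((tensorToHom M N).app U (∑ i, tmul (m i) (e i))) V h φ =
      ∑ i, pairing φ (res N h (e i)) • res M h (m i) := by
  let ev : HomSec (dual N) M U →+ Γ(M, V) :=
    { toFun := fun ψ => ψ.app V h φ, map_zero' := rfl, map_add' := fun _ _ => rfl }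
  change ev _ = _
  rw [map_sum]
  refine (map_sum ev _ _).trans (Finset.sum_congr rfl fun i _ => ?_)
  rw [tensorToHom_tmul]
  rfl

/-- Over a frame `e` of `N` with dual frame `e^*`, the inverse is `τ ↦ ∑ τ(e_i^*) ⊗ e_i`. No global
inverse has to be glued: being mono and being epi can each be checked locally. -/
lemma isIso_tensorToHom {N : X.Modules} (hN : IsVectorBundle N) (M : X.Modules) :
    IsIso (tensorToHom M N) := by
  have h1 : Mono (tensorToHom M N) := by
    refine mono_of_injective _ fun U => (injective_iff_map_eq_zero _).2 fun t ht => ?_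
    refine eq_of_locally_eq _ t 0 fun x hx => ?_
    obtain ⟨V, h, hxV, n, e, m, he, hm⟩ := exists_local_eq_sum_tmul hN t x hx
    refine ⟨V, h, hxV, ?_⟩
    rw [map_zero, hm]
    have h0 : (tensorToHom M N).app V (∑ i, tmul (m i) (e i)) = 0 := by
      rw [← hm, app_res, ht, map_zero]
    refine Finset.sum_eq_zero fun j _ => ?_
    -- Evaluation at the `j`-th dual frame member isolates `m j`, which is therefore zero.
    have hj := tensorToHom_app_sum_tmul (e := e) m le_rfl (he.dualFrame j)
    rw [h0, Finset.sum_eq_single j] at hj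
    · simp only [res_self, he.pairing_dualFrame, if_pos, one_smul] at hj
      rw [← hj]
      change tmul 0 (e j) = 0
      exact (congrArg _ (TensorProduct.zero_tmul _ _)).trans
        (map_zero ((toSheafify (tensorPresheaf M N)).app (op V)).hom)
    · intro i _ hi
      rw [res_self, he.pairing_dualFrame, if_neg hi, zero_smul]
    · simp
  have h2 : Epi (tensorToHom M N) := by
    refine epi_of_locallySurjective _ fun U t x hx => ?_
    let τ : HomSec (dual N) M U := t
    obtain ⟨U', hx', n, e, he⟩ := hN x
    have hV : U ⊓ U' ≤ U := inf_le_left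
    have hV' : U ⊓ U' ≤ U' := inf_le_right
    refine ⟨U ⊓ U', hV, ⟨hx, hx'⟩, ∑ i, tmul
      (τ.app _ hV (he.isFrame_dualFrame.basis hV' i)) (res N hV' (e i)), ?_⟩
    -- Linear maps out of the dual need only be compared on the basis given by the dual frame.
    refine HomSec.ext (x := (_ : HomSec (dual N) M (U ⊓ U'))) (y := HomSec.restr hV τ) ?_
    funext W k
    refine (he.isFrame_dualFrame.basis (k.trans hV')).ext fun j => ?_
    rw [tensorToHom_app_sum_tmul, Finset.sum_eq_single j]
    · rw [IsFrame.basis_apply, ← res_res (dual N) hV' k, res_res N, ← τ.compat]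
      rw [IsFrame.basis_apply, res_res, pairing_res, he.pairing_dualFrame, if_pos rfl, map_one,
        one_smul]
      rfl
    · intro i _ hi
      rw [IsFrame.basis_apply, res_res, pairing_res, he.pairing_dualFrame, if_neg hi, map_zero,
        zero_smul]
    · simp
  exact isIso_of_mono_of_epi _

/-- The isomorphism `M ⊗ N ≅ ℋom(N^*, M)` for a vector bundle `N`. -/
def tensorHomIso {N : X.Modules} (hN : IsVectorBundle N) (M : X.Modules) :
    tensor M N ≅ sheafHom (dual N) M :=
  have := isIso_tensorToHom hN M
  asIso (tensorToHom M N)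

end TensorToHom

/-! ### Exactness of tensoring with a vector bundle -/

section TensorExactness

/-- The sequence `S₁ ⊗ N ⟶ S₂ ⊗ N ⟶ S₃ ⊗ N`. -/
def tensorSeq (S : ShortComplex X.Modules) (N : X.Modules) : ShortComplex X.Modules :=
  .mk (tensorMap S.f (𝟙 N)) (tensorMap S.g (𝟙 N)) (by
    rw [tensorMap_comp, S.zero, zero_tensorMap])

lemma dualMap_id (N : X.Modules) : dualMap (𝟙 N) = 𝟙 (dual N) := rfl

lemma sheafHomPre_id (M N : X.Modules) : sheafHomPre (𝟙 M) N = 𝟙 (sheafHom M N) := rfl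

lemma tensorToHom_naturality_left {M M' : X.Modules} (f : M ⟶ M') (N : X.Modules) :
    tensorMap f (𝟙 N) ≫ tensorToHom M' N = tensorToHom M N ≫ sheafHomMap (dual N) f := by
  rw [tensorToHom_naturality, dualMap_id, sheafHomPre_id, Category.comp_id]

/-- The sequence is isomorphic, through `tensorToHom`, to `ℋom(N^*, S)`, which is exact because
`N^*` is again a vector bundle. -/
lemma tensorSeq_shortExact {N : X.Modules} (hN : IsVectorBundle N)
    {S : ShortComplex X.Modules} (hS : S.ShortExact) : (tensorSeq S N).ShortExact := by
  refine (ShortComplex.shortExact_iff_of_iso (S₂ := sheafHomSeq (dual N) S) ?_).2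
    (hN.dual.sheafHomSeq_shortExact hS)
  exact ShortComplex.isoMk (tensorHomIso hN S.X₁) (tensorHomIso hN S.X₂)
    (tensorHomIso hN S.X₃) (tensorToHom_naturality_left S.f N).symm
    (tensorToHom_naturality_left S.g N).symm

lemma tensorMap_id_left {M N N' : X.Modules} (g : N ⟶ N') :
    tensorMap (𝟙 M) g = braid M N ≫ tensorMap g (𝟙 M) ≫ braid N' M := by
  rw [tensorMap_braid, reassoc_of% braid_braid]

/-- The sequence `M ⊗ S₁ ⟶ M ⊗ S₂ ⟶ M ⊗ S₃`. -/
def tensorSeqLeft (M : X.Modules) (S : ShortComplex X.Modules) : ShortComplex X.Modules :=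
  .mk (tensorMap (𝟙 M) S.f) (tensorMap (𝟙 M) S.g) (by
    rw [tensorMap_id_left, tensorMap_id_left]
    simp only [Category.assoc, reassoc_of% braid_braid]
    rw [← Category.assoc (tensorMap S.f _), tensorMap_comp, S.zero, zero_tensorMap,
      Limits.zero_comp, Limits.comp_zero])

lemma tensorSeqLeft_shortExact {M : X.Modules} (hM : IsVectorBundle M)
    {S : ShortComplex X.Modules} (hS : S.ShortExact) : (tensorSeqLeft M S).ShortExact :=
  (ShortComplex.shortExact_iff_of_iso (S₂ := tensorSeq S M)
    (ShortComplex.isoMk (braidIso M S.X₁) (braidIso M S.X₂) (braidIso M S.X₃)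
      (tensorMap_braid (𝟙 M) S.f).symm (tensorMap_braid (𝟙 M) S.g).symm)).2
    (tensorSeq_shortExact hM hS)

end TensorExactness

/-! ### Division by 2 over `ℂ` -/

section Halving

/-- On a scheme over `ℂ`, every `𝒪_X`-module has an endomorphism that is multiplication
by `1 / 2`. -/
lemma exists_half (f : X ⟶ Spec (CommRingCat.of ℂ)) (M : X.Modules) :
    ∃ h : M ⟶ M, h + h = 𝟙 M := by
  let c : ℂ →+* Γ(X, ⊤) := ((Scheme.ΓSpecIso (CommRingCat.of ℂ)).inv ≫ f.appTop).hom
  let r : Γ(X, ⊤) := c (1 / 2)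
  have hr : r + r = 1 := by
    rw [← map_add, add_halves, map_one]
  let s (U : X.Opens) : Γ(X, U) := X.presheaf.map (homOfLE (le_top : U ≤ ⊤)).op r
  have hs (U : X.Opens) : s U + s U = 1 := by rw [← map_add, hr, map_one]
  refine ⟨mkHom (fun U => s U • LinearMap.id) fun {U V} h m => ?_, ?_⟩
  · rw [LinearMap.smul_apply, LinearMap.smul_apply, LinearMap.id_apply, LinearMap.id_apply,
      res_smul]
    congr 1
    exact ConcreteCategory.congr_hom
      (X.presheaf.map_comp (homOfLE (le_top : U ≤ ⊤)).op (homOfLE h).op) r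
  · refine Scheme.Modules.hom_ext _ _ fun U => ?_
    ext m
    change s U • m + s U • m = m
    rw [← add_smul, hs, one_smul]

end Halving

/-! ### The exact sequence `0 ⟶ Sym² E / Sym² F ⟶ G ⊗ E ⟶ ∧² G ⟶ 0` -/

section SymmetricSquareExactness

variable {F E G : X.Modules}

lemma swap_swap (M : X.Modules) : swap M ≫ swap M = 𝟙 _ := braid_braid M M

lemma sym2ι_swap (E : X.Modules) : sym2ι E ≫ swap E = sym2ι E := by
  have h : sym2ι E ≫ (𝟙 (tensor E E) - swap E) = 0 := Limits.kernel.condition _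
  rw [Preadditive.comp_sub, Category.comp_id, sub_eq_zero] at h
  exact h.symm

instance (E : X.Modules) : Mono (sym2ι E) :=
  inferInstanceAs (Mono (Limits.kernel.ι (𝟙 (tensor E E) - swap E)))

lemma exists_sym2_lift {A : X.Modules} (k : A ⟶ tensor E E) (hk : k ≫ swap E = k) :
    ∃ l : A ⟶ sym2 E, l ≫ sym2ι E = k :=
  ⟨Limits.kernel.lift (𝟙 (tensor E E) - swap E) k (by
    rw [Preadditive.comp_sub, hk, Category.comp_id, sub_self]), Limits.kernel.lift_ι _ _ _⟩

lemma tensorMap_exchange {M N M' N' : X.Modules} (f : M ⟶ M') (g : N ⟶ N') :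
    tensorMap f (𝟙 N) ≫ tensorMap (𝟙 M') g = tensorMap (𝟙 M) g ≫ tensorMap f (𝟙 N') := by
  simp only [tensorMap_comp, Category.comp_id, Category.id_comp]

lemma mono_tensorMap_self (hF : IsVectorBundle F) (hE : IsVectorBundle E) {i : F ⟶ E} {q : E ⟶ G}
    {w : i ≫ q = 0} (h : (ShortComplex.mk i q w).ShortExact) : Mono (tensorMap i i) := by
  have h1 : Mono (tensorMap (𝟙 F) i) := (tensorSeqLeft_shortExact hF h).mono_f
  have h2 : Mono (tensorMap i (𝟙 E)) := (tensorSeq_shortExact hE h).mono_f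
  have : tensorMap i i = tensorMap (𝟙 F) i ≫ tensorMap i (𝟙 E) := by
    rw [tensorMap_comp, Category.id_comp, Category.comp_id]
  rw [this]
  infer_instance

lemma mono_sym2Map {i : F ⟶ E} [Mono (tensorMap i i)] : Mono (sym2Map i) := by
  have : Mono (sym2Map i ≫ sym2ι E) := by
    rw [sym2Map_ι]
    infer_instance
  exact mono_of_mono _ (sym2ι E)

lemma symQuot_shortExact (i : F ⟶ E) [Mono (tensorMap i i)] :
    (ShortComplex.mk (sym2Map i) (toSymQuot i) (Limits.cokernel.condition _)).ShortExact := by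
  have : Mono (sym2Map i) := mono_sym2Map
  have : Epi (toSymQuot i) := inferInstanceAs (Epi (Limits.cokernel.π (sym2Map i)))
  exact ShortComplex.ShortExact.mk' (ShortComplex.exact_cokernel (sym2Map i)) ‹_› ‹_›

/-- It must be shown that `Sym² F` is the whole kernel of `Sym² E ⟶ G ⊗ E`. A symmetric tensor in
that kernel lies in `F ⊗ E`, hence by symmetry also in `E ⊗ F`, hence in `F ⊗ F`. It is symmetric
there because `F ⊗ F ⟶ E ⊗ E` is mono. -/
lemma mono_symQuotι (hF : IsVectorBundle F) (hE : IsVectorBundle E) (hG : IsVectorBundle G)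
    {i : F ⟶ E} {q : E ⟶ G} {w : i ≫ q = 0} (h : (ShortComplex.mk i q w).ShortExact) :
    Mono (symQuotι i q w) := by
  have hii := mono_tensorMap_self hF hE h
  have hiE := tensorSeq_shortExact hE h
  have hFi := tensorSeqLeft_shortExact hF h
  have hiG : Mono (tensorMap i (𝟙 G)) := (tensorSeq_shortExact hG h).mono_f
  have := mono_sym2Map (i := i)
  have w' : sym2Map i ≫ sym2ι E ≫ tensorMap q (𝟙 E) = 0 := by
    rw [← toSymQuot_ι i q w, ← Category.assoc,
      show sym2Map i ≫ toSymQuot i = 0 from Limits.cokernel.condition _, Limits.zero_comp]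
  refine ShortComplex.Exact.mono_cokernelDesc (S := ShortComplex.mk _ _ w') ?_
  refine ShortComplex.exact_of_f_is_kernel _
    (Limits.KernelFork.IsLimit.ofι' (sym2Map i) w' fun {A} k hk => Nonempty.some ?_)
  obtain ⟨a, ha⟩ : ∃ a : A ⟶ tensor F E, a ≫ tensorMap i (𝟙 E) = k ≫ sym2ι E :=
    have := hiE.mono_f
    ⟨hiE.exact.lift (k ≫ sym2ι E) ((Category.assoc _ _ _).trans hk), hiE.exact.lift_f _ _⟩
  -- After embedding in `E ⊗ G` this is `1 ⊗ q` applied to `k`; by symmetry of `k` it is the flip of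
  -- `q ⊗ 1` applied to `k`, which vanishes.
  have ha' : a ≫ tensorMap (𝟙 F) q = 0 := by
    rw [← cancel_mono (tensorMap i (𝟙 G)), Category.assoc, ← tensorMap_exchange, ← Category.assoc,
      ha, Category.assoc, ← sym2ι_swap, Category.assoc, ← braid_self, ← tensorMap_braid,
      Limits.zero_comp, reassoc_of% hk, Limits.zero_comp]
  obtain ⟨b, hb⟩ : ∃ b : A ⟶ tensor F F, b ≫ tensorMap (𝟙 F) i = a :=
    have := hFi.mono_f
    ⟨hFi.exact.lift a ha', hFi.exact.lift_f _ _⟩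
  have hb' : b ≫ tensorMap i i = k ≫ sym2ι E := by
    rw [← ha, ← hb, Category.assoc, tensorMap_comp, Category.id_comp, Category.comp_id]
  obtain ⟨l, hl⟩ := exists_sym2_lift b (by
    rw [← cancel_mono (tensorMap i i), Category.assoc, ← tensorMap_swap, reassoc_of% hb',
      sym2ι_swap, hb'])
  refine ⟨l, ?_⟩
  rw [← cancel_mono (sym2ι E), Category.assoc, sym2Map_ι, reassoc_of% hl, hb']

/-- Let `u` in `G ⊗ E` have symmetric image in `G ⊗ G`, and lift it to `t` in `E ⊗ E`. The image of
`t - swap t` in `G ⊗ E` dies in `G ⊗ G`, so it comes from `G ⊗ F` and lifts to some `e'` in `E ⊗ F`.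
With `r = t + e'`, the symmetric tensor `r + swap r` maps to `2u`, and dividing by 2 gives a
preimage. Lifts along epimorphisms exist only after passing to covers `A₁`, `A₂` of the test object.
-/
lemma symQuotSeq_exact (f : X ⟶ Spec (CommRingCat.of ℂ)) (hE : IsVectorBundle E)
    (hF : IsVectorBundle F) (hG : IsVectorBundle G) {i : F ⟶ E} {q : E ⟶ G} {w : i ≫ q = 0}
    (h : (ShortComplex.mk i q w).ShortExact) : (symQuotSeq i q w).Exact := by
  have hqE : Epi (tensorMap q (𝟙 E)) := (tensorSeq_shortExact hE h).epi_g
  have hqF : Epi (tensorMap q (𝟙 F)) := (tensorSeq_shortExact hF h).epi_g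
  have hGi := tensorSeqLeft_shortExact hG h
  rw [ShortComplex.exact_iff_exact_up_to_refinements]
  intro A u hu
  change A ⟶ tensor G E at u
  have hu' : u ≫ tensorMap (𝟙 G) q ≫ swap G = u ≫ tensorMap (𝟙 G) q := by
    have h1 : (u ≫ tensorMap (𝟙 G) q ≫ toAlt2 G) ≫ alt2ι G = 0 := by
      rw [show u ≫ tensorMap (𝟙 G) q ≫ toAlt2 G = 0 from hu, Limits.zero_comp]
    simp only [Category.assoc, toAlt2_ι, Preadditive.comp_sub, Category.comp_id] at h1
    exact (sub_eq_zero.1 h1).symm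
  obtain ⟨A₁, π₁, hπ₁, t, ht⟩ := surjective_up_to_refinements_of_epi (tensorMap q (𝟙 E)) u
  have hqq : tensorMap q q = tensorMap q (𝟙 E) ≫ tensorMap (𝟙 G) q := by
    rw [tensorMap_comp, Category.id_comp, Category.comp_id]
  have h2 : ((t - t ≫ swap E) ≫ tensorMap q (𝟙 E)) ≫ tensorMap (𝟙 G) q = 0 := by
    rw [Category.assoc, ← hqq, Preadditive.sub_comp, Category.assoc, ← tensorMap_swap, hqq,
      Category.assoc, ← reassoc_of% ht, ← reassoc_of% ht, hu', sub_self]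
  obtain ⟨e, he⟩ : ∃ e : A₁ ⟶ tensor G F,
      e ≫ tensorMap (𝟙 G) i = (t - t ≫ swap E) ≫ tensorMap q (𝟙 E) :=
    have := hGi.mono_f
    ⟨hGi.exact.lift _ h2, hGi.exact.lift_f _ _⟩
  obtain ⟨A₂, π₂, hπ₂, e', he'⟩ := surjective_up_to_refinements_of_epi (tensorMap q (𝟙 F)) e
  -- Under `q ⊗ 1` the four terms of `r + swap r` give `u`, `u - (q ⊗ 1)(swap t)`, `(q ⊗ 1)(swap t)`
  -- and `0`; the last because `swap e'` lies in `F ⊗ E`.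
  let r : A₂ ⟶ tensor E E := π₂ ≫ t + e' ≫ tensorMap (𝟙 E) i
  obtain ⟨s, hs⟩ := exists_sym2_lift (r + r ≫ swap E) (by
    rw [Preadditive.add_comp, Category.assoc, swap_swap, Category.comp_id, add_comm])
  have key : s ≫ sym2ι E ≫ tensorMap q (𝟙 E) = π₂ ≫ π₁ ≫ u + π₂ ≫ π₁ ≫ u := by
    have h3 : (e' ≫ tensorMap (𝟙 E) i) ≫ tensorMap q (𝟙 E) =
        π₂ ≫ (t - t ≫ swap E) ≫ tensorMap q (𝟙 E) := by
      rw [Category.assoc, ← tensorMap_exchange, ← reassoc_of% he', he]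
    have h4 : ((e' ≫ tensorMap (𝟙 E) i) ≫ swap E) ≫ tensorMap q (𝟙 E) = 0 := by
      rw [← braid_self, Category.assoc, Category.assoc, reassoc_of% tensorMap_braid,
        tensorMap_comp, w, zero_tensorMap, Limits.comp_zero, Limits.comp_zero]
    rw [reassoc_of% hs]
    simp only [r, Preadditive.add_comp, h3, h4]
    simp only [Preadditive.sub_comp, Preadditive.comp_sub, Category.assoc, ← ht]
    abel
  -- Halving is done on the source `A₂`, so compatibility with the other maps is automatic.
  obtain ⟨η, hη⟩ := exists_half f A₂
  refine ⟨A₂, π₂ ≫ π₁, epi_comp _ _, η ≫ s ≫ toSymQuot i, ?_⟩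
  change (π₂ ≫ π₁) ≫ u = (η ≫ s ≫ toSymQuot i) ≫ symQuotι i q w
  simp only [Category.assoc]
  rw [toSymQuot_ι, key, Preadditive.comp_add, ← Preadditive.add_comp, hη, Category.id_comp]

lemma symQuotSeq_shortExact (f : X ⟶ Spec (CommRingCat.of ℂ)) (hF : IsVectorBundle F)
    (hE : IsVectorBundle E) (hG : IsVectorBundle G) {i : F ⟶ E} {q : E ⟶ G} {w : i ≫ q = 0}
    (h : (ShortComplex.mk i q w).ShortExact) : (symQuotSeq i q w).ShortExact := by
  have h1 : Epi (tensorMap (𝟙 G) q) := (tensorSeqLeft_shortExact hG h).epi_g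
  have h2 : Epi (toAlt2 G) :=
    inferInstanceAs (Epi (Limits.factorThruImage (𝟙 (tensor G G) - swap G)))
  exact ShortComplex.ShortExact.mk' (symQuotSeq_exact f hE hF hG h)
    (mono_symQuotι hF hE hG h) (epi_comp (tensorMap (𝟙 G) q) (toAlt2 G))

end SymmetricSquareExactness

/-! ### The long exact cohomology sequence in degrees 0 and 1 -/

section LongExactSequence

lemma H.map_comp_apply {M N K : X.Modules} (f : M ⟶ N) (g : N ⟶ K) (n : ℕ) (x : H M n) :
    H.map (f ≫ g) n x = H.map g n (H.map f n x) := by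
  simp only [H.map, Functor.map_comp, Sheaf.H.map_comp_apply]

lemma H.map_id_apply (M : X.Modules) (n : ℕ) (x : H M n) : H.map (𝟙 M) n x = x :=
  (congrArg (fun g => Sheaf.H.map g n x) ((toAb X).map_id M)).trans (Sheaf.H.map_id_apply x)

lemma H.map_injective_of_retraction {M N : X.Modules} (f : M ⟶ N) (g : N ⟶ M) (h : f ≫ g = 𝟙 M)
    (n : ℕ) : Function.Injective (H.map f n) :=
  Function.LeftInverse.injective (g := H.map g n) fun x => by
    rw [← H.map_comp_apply, h, H.map_id_apply]

lemma H.map_zero_injective {M N : X.Modules} (f : M ⟶ N) [Mono f] :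
    Function.Injective (H.map f 0) :=
  Abelian.Ext.postcomp_mk₀_injective_of_mono _ ((toAb X).map f)

lemma H.map_ofSection {M N : X.Modules} (f : M ⟶ N) (s : Γ(M, ⊤)) :
    H.map f 0 (H.ofSection s) = H.ofSection (f.app ⊤ s) :=
  Sheaf.H.equiv₀_symm_naturality (f := (toAb X).map f) Limits.isTerminalTop s

lemma H.ofSection_bijective (M : X.Modules) :
    Function.Bijective (H.ofSection : Γ(M, ⊤) → H M 0) :=
  (Sheaf.H.equiv₀ ((toAb X).obj M) Limits.isTerminalTop).symm.bijective

/-- Cohomology is `Ext` out of a fixed abelian sheaf, and `toAb` preserves short exactness. This and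
the next two lemmas are thus instances of the covariant long exact `Ext` sequence. -/
lemma H.mem_range_map_f_iff {S : ShortComplex X.Modules} (hS : S.ShortExact)
    (n : ℕ) (x : H S.X₂ n) :
    x ∈ (H.map S.f n).range ↔ H.map S.g n x = 0 := by
  refine ⟨?_, fun h => Abelian.Ext.covariant_sequence_exact₂ _ (hS.map_of_exact (toAb X)) x h⟩
  rintro ⟨y, rfl⟩
  rw [← H.map_comp_apply, S.zero]
  simp [H.map, Sheaf.H.map_apply]

lemma H.mem_range_connecting_iff {S : ShortComplex X.Modules} (hS : S.ShortExact)
    (x : H S.X₁ 1) :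
    x ∈ (connecting hS).range ↔ H.map S.f 1 x = 0 := by
  refine ⟨?_, fun h => Abelian.Ext.covariant_sequence_exact₁ _ (hS.map_of_exact (toAb X)) x h
    (zero_add 1)⟩
  rintro ⟨y, rfl⟩
  have hS' := hS.map_of_exact (toAb X)
  refine (Abelian.Ext.comp_assoc_of_third_deg_zero y hS'.extClass
    (Abelian.Ext.mk₀ (S.map (toAb X)).f) (zero_add 1)).trans ?_
  exact (congrArg (fun z => Abelian.Ext.comp y z (zero_add 1)) hS'.extClass_comp).trans
    (Abelian.Ext.comp_zero _ _ _ _ _)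

lemma H.mem_range_map_g_iff {S : ShortComplex X.Modules} (hS : S.ShortExact)
    (x : H S.X₃ 0) :
    x ∈ (H.map S.g 0).range ↔ connecting hS x = 0 := by
  refine ⟨?_, fun h => Abelian.Ext.covariant_sequence_exact₃ _ (hS.map_of_exact (toAb X)) x
    (zero_add 1) h⟩
  rintro ⟨y, rfl⟩
  have hS' := hS.map_of_exact (toAb X)
  refine (Abelian.Ext.comp_assoc_of_second_deg_zero y (Abelian.Ext.mk₀ (S.map (toAb X)).g)
    hS'.extClass (zero_add 1)).trans ?_
  exact (congrArg (fun z => Abelian.Ext.comp y z (zero_add 1)) hS'.comp_extClass).trans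
    (Abelian.Ext.comp_zero _ _ _ _ _)

lemma connecting_injective {S : ShortComplex X.Modules} (hS : S.ShortExact)
    (h : Subsingleton (H S.X₂ 0)) : Function.Injective (connecting hS) :=
  (injective_iff_map_eq_zero _).2 fun x hx => by
    obtain ⟨y, rfl⟩ := (H.mem_range_map_g_iff hS x).2 hx
    rw [Subsingleton.elim y 0, map_zero]

lemma H.map_one_injective {S : ShortComplex X.Modules} (hS : S.ShortExact)
    (h : Subsingleton (H S.X₃ 0)) : Function.Injective (H.map S.f 1) :=
  (injective_iff_map_eq_zero _).2 fun x hx => by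
    obtain ⟨y, rfl⟩ := (H.mem_range_connecting_iff hS x).2 hx
    rw [Subsingleton.elim y 0, map_zero]

lemma H.range_connecting_eq_bot {S : ShortComplex X.Modules} (hS : S.ShortExact)
    (h : Subsingleton (H S.X₃ 0)) : (connecting hS).range = ⊥ :=
  (AddSubgroup.eq_bot_iff_forall _).2 (by
    rintro _ ⟨y, rfl⟩
    rw [Subsingleton.elim y 0, map_zero])

/-- The connecting map is composition with the extension class, so this follows from naturality of
that class and associativity of the `Ext` product. -/
lemma connecting_naturality {S T : ShortComplex X.Modules} (hS : S.ShortExact)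
    (hT : T.ShortExact) (φ : S ⟶ T) (x : H S.X₃ 0) :
    H.map φ.τ₁ 1 (connecting hS x) = connecting hT (H.map φ.τ₃ 0 x) := by
  have h := (hS.map_of_exact (toAb X)).extClass_naturality (hT.map_of_exact (toAb X))
    ((toAb X).mapShortComplex.map φ)
  refine (Abelian.Ext.comp_assoc_of_third_deg_zero x (hS.map_of_exact (toAb X)).extClass
    (Abelian.Ext.mk₀ ((toAb X).map φ.τ₁)) (zero_add 1)).trans ?_
  refine (congrArg (fun y => Abelian.Ext.comp x y (zero_add 1)) h).trans ?_
  exact (Abelian.Ext.comp_assoc_of_second_deg_zero x (Abelian.Ext.mk₀ ((toAb X).map φ.τ₃))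
    (hT.map_of_exact (toAb X)).extClass (zero_add 1)).symm

end LongExactSequence

/-! ### The obstruction to lifting, and symmetric classes -/

section Lifting

/-- A morphism, as a global section of the sheaf of homomorphisms. -/
def homSection {M N : X.Modules} (f : M ⟶ N) : Γ(sheafHom M N, ⊤) :=
  (⟨fun V _ => appₗ f V, fun _ k m => app_res f k m⟩ : HomSec M N ⊤)

lemma homSection_injective {M N : X.Modules} :
    Function.Injective (homSection : (M ⟶ N) → Γ(sheafHom M N, ⊤)) := fun f g h => by
  refine Scheme.Modules.hom_ext _ _ fun U => ?_
  ext m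
  exact congrArg (fun φ : HomSec M N ⊤ => φ.app U le_top m) h

lemma homSection_surjective {M N : X.Modules} :
    Function.Surjective (homSection : (M ⟶ N) → Γ(sheafHom M N, ⊤)) := fun φ =>
  ⟨mkHom (fun U => HomSec.app (M := M) (N := N) φ U le_top)
    fun h m => HomSec.compat (M := M) (N := N) φ le_top h m, rfl⟩

/-- A morphism `f : M ⟶ S.X₃` lifts to `S.X₂` if and only if its image under the connecting
homomorphism of `ℋom(M, S)` vanishes. -/
lemma exists_lift_iff {M : X.Modules} (hM : IsVectorBundle M) {S : ShortComplex X.Modules}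
    (hS : S.ShortExact) (f : M ⟶ S.X₃) : (∃ l : M ⟶ S.X₂, l ≫ S.g = f) ↔
      connecting (hM.sheafHomSeq_shortExact hS) (H.ofSection (homSection f)) = 0 := by
  -- Vanishing under the connecting map means coming from `H⁰(ℋom(M, S.X₂))`, whose elements are the
  -- morphisms `M ⟶ S.X₂`.
  rw [← H.mem_range_map_g_iff]
  constructor
  · rintro ⟨l, rfl⟩
    exact ⟨H.ofSection (homSection l), H.map_ofSection (sheafHomMap M S.g) (homSection l)⟩
  · rintro ⟨y, hy⟩
    obtain ⟨s, rfl⟩ := (H.ofSection_bijective _).2 y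
    obtain ⟨l, rfl⟩ := homSection_surjective s
    refine ⟨l, homSection_injective ((H.ofSection_bijective _).1 ?_)⟩
    exact (H.map_ofSection (sheafHomMap M S.g) (homSection l)).symm.trans hy

/-- Composition with `f : M ⟶ M'`, as a morphism from `ℋom(M', S)` to `ℋom(M, S)`. -/
def sheafHomSeqPre {M M' : X.Modules} (f : M ⟶ M') (S : ShortComplex X.Modules) :
    sheafHomSeq M' S ⟶ sheafHomSeq M S where
  τ₁ := sheafHomPre f S.X₁
  τ₂ := sheafHomPre f S.X₂
  τ₃ := sheafHomPre f S.X₃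
  comm₁₂ := rfl
  comm₂₃ := rfl

/-- The dual `G^*` lifts to `W` if and only if the class of `W` vanishes in `H¹(ℋom(G^*, E))`. -/
lemma lifts_iff {E G W : X.Modules} (hE : IsVectorBundle E) (hG : IsVectorBundle G) (q : E ⟶ G)
    {j : E ⟶ W} {p : W ⟶ dual E} {w : j ≫ p = 0} (hW : (ShortComplex.mk j p w).ShortExact) :
    Lifts q p ↔ H.map (sheafHomPre (dualMap q) E) 1 (extensionClass hE hW) = 0 := by
  refine (exists_lift_iff hG.dual hW (dualMap q)).trans ?_
  refine Eq.congr_left ?_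
  -- The section given by `dualMap q` is the identity section of `E^*` precomposed with `dualMap q`,
  -- so naturality moves the restriction past the connecting map.
  refine Eq.trans ?_ (connecting_naturality (hE.dual.sheafHomSeq_shortExact hW)
    (hG.dual.sheafHomSeq_shortExact hW) (sheafHomSeqPre (dualMap q) _) _).symm
  exact congrArg _ (H.map_ofSection (sheafHomPre (dualMap q) (dual E)) (idSection (dual E))).symm

/-- Both factors are split: `tensorToHom E E` is an isomorphism, and half of `1 + swap` retracts `E
⊗ E` onto `Sym² E`. -/
lemma symClassMap_injective (f : X ⟶ Spec (CommRingCat.of ℂ)) {E : X.Modules}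
    (hE : IsVectorBundle E) : Function.Injective (symClassMap E) := by
  have := isIso_tensorToHom hE E
  obtain ⟨η, hη⟩ := exists_half f (sym2 E)
  obtain ⟨s, hs⟩ := exists_sym2_lift (𝟙 (tensor E E) + swap E) (by
    rw [Preadditive.add_comp, swap_swap, Category.id_comp, add_comm])
  refine (H.map_injective_of_retraction (tensorToHom E E) (inv (tensorToHom E E))
    (IsIso.hom_inv_id _) 1).comp (H.map_injective_of_retraction (sym2ι E) (s ≫ η) ?_ 1)
  have h : sym2ι E ≫ s = 𝟙 _ + 𝟙 _ := by
    rw [← cancel_mono (sym2ι E), Category.assoc, hs, Preadditive.comp_add, sym2ι_swap,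
      Category.comp_id, Preadditive.add_comp, Category.id_comp]
  rw [reassoc_of% h, Preadditive.add_comp, Category.id_comp, hη]

/-- For a symmetric class, restriction to `ℋom(G^*, E)` and projection to `G ⊗ E` have the same
kernel. -/
lemma map_symClassMap_eq_zero_iff {F E G : X.Modules} (hG : IsVectorBundle G) (i : F ⟶ E)
    (q : E ⟶ G) (w : i ≫ q = 0) (δ : H (sym2 E) 1) :
    H.map (sheafHomPre (dualMap q) E) 1 (symClassMap E δ) = 0 ↔
      H.map (symQuotι i q w) 1 (H.map (toSymQuot i) 1 δ) = 0 := by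
  have := isIso_tensorToHom hG E
  -- Symmetry enters here: restriction along `G^* ⊂ E^*` is `1 ⊗ q` on `E ⊗ E`, and on tensors fixed
  -- by the flip it becomes `q ⊗ 1` followed by `braid G E`.
  have h : (sym2ι E ≫ tensorToHom E E) ≫ sheafHomPre (dualMap q) E =
      (toSymQuot i ≫ symQuotι i q w) ≫ braid G E ≫ tensorToHom E G := by
    have hq := tensorToHom_naturality (𝟙 E) q
    rw [show sheafHomMap (dual E) (𝟙 E) = 𝟙 _ from rfl, Category.id_comp] at hq
    rw [toSymQuot_ι, Category.assoc, Category.assoc, ← hq, reassoc_of% tensorMap_braid, braid_self,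
      reassoc_of% sym2ι_swap]
  have h' : H.map (sheafHomPre (dualMap q) E) 1 (symClassMap E δ) =
      H.map (braid G E ≫ tensorToHom E G) 1
        (H.map (symQuotι i q w) 1 (H.map (toSymQuot i) 1 δ)) := by
    rw [← H.map_comp_apply (toSymQuot i), ← H.map_comp_apply (toSymQuot i ≫ _), ← h,
      H.map_comp_apply, H.map_comp_apply]
    rfl
  rw [h']
  refine (injective_iff_map_eq_zero' _).1 (H.map_injective_of_retraction _
    (inv (tensorToHom E G) ≫ braid E G) ?_ 1) _
  rw [Category.assoc, IsIso.hom_inv_id_assoc, braid_braid]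

end Lifting

end SymplecticLifting
end

open SymplecticLifting
-- The symplectic condition is expressed by a preimage `δ` of the extension class under `symClassMap
-- E`; injectivity of that map makes `δ` unique.
theorem mainTheorem8 (X : Scheme.{0}) (f : X ⟶ Spec (CommRingCat.of ℂ)) [IsIntegral X]
    [IsProper f] [SmoothOfRelativeDimension 1 f]
    (F E G : X.Modules) (hF : IsVectorBundle F) (hE : IsVectorBundle E) (hG : IsVectorBundle G)
    (i : F ⟶ E) (q : E ⟶ G) (hiq : i ≫ q = 0) (hFEG : (ShortComplex.mk i q hiq).ShortExact)
    (hGE : Subsingleton (H (tensor G E) 0)) :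
    ∃ hS : (symQuotSeq i q hiq).ShortExact,
      Function.Injective (connecting hS) ∧
      Function.Injective (H.map (sym2Map i) 1) ∧
      Function.Injective (symClassMap E) ∧
      ∀ (W : X.Modules) (j : E ⟶ W) (p : W ⟶ dual E) (hjp : j ≫ p = 0)
        (hW : (ShortComplex.mk j p hjp).ShortExact) (δ : H (sym2 E) 1),
        symClassMap E δ = extensionClass hE hW →
        (Lifts q p ↔ δ ∈ (connecting hS).range.comap (H.map (toSymQuot i) 1)) ∧
        (Subsingleton (H (alt2 G) 0) → (Lifts q p ↔ δ ∈ (H.map (sym2Map i) 1).range)) := by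
  have hii := mono_tensorMap_self hF hE hFEG
  have hS := symQuotSeq_shortExact f hF hE hG hFEG
  have hQ := symQuot_shortExact i
  have hι : Mono (symQuotι i q hiq) := hS.mono_f
  -- `H⁰` preserves the inclusion of `Sym² E / Sym² F` in `G ⊗ E`, whose `H⁰` is zero.
  have hQ0 : Subsingleton (H (symQuot i) 0) :=
    (H.map_zero_injective (symQuotι i q hiq)).subsingleton
  have hQ1 := H.map_one_injective hQ hQ0
  refine ⟨hS, connecting_injective hS hGE, hQ1,
    symClassMap_injective f hE, fun W j p hjp hW δ hδ => ?_⟩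
  have key : Lifts q p ↔ δ ∈ (connecting hS).range.comap (H.map (toSymQuot i) 1) := by
    rw [lifts_iff hE hG q hW, ← hδ, map_symClassMap_eq_zero_iff hG i q hiq]
    exact (H.mem_range_connecting_iff hS _).symm
  refine ⟨key, fun h0 => key.trans ?_⟩
  -- With `H⁰(∧² G) = 0` the condition becomes `b(δ) = 0`, and the kernel of `b` is the image of
  -- `H¹(Sym² F)`.
  rw [H.range_connecting_eq_bot hS h0]
  have h1 := H.mem_range_map_f_iff hQ 1 δ
  exact h1.symm
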